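/- **Setting.** Let $0<\mu<L$, $d\in\mathbb N$, and let $f:\mathbb R^d\to\mathbb R$ be $\mu$-strongly convex and continuously differentiable with $L$-Lipschitz gradient, with minimizer $x_*$ and $f_*=f(x_*)$. Let $\alpha>0$, $\beta,\nu\ge 0$, $x_0=x_{-1}\in\mathbb R^d$ (deterministic), and consider, for $k\ge 0$, $$x_{k+1}=x_k-\alpha\bigl(\nabla f(y_k)+w_{k+1}\bigr)+\beta(x_k-x_{k-1}),\qquad y_k=x_k+\nu(x_k-x_{k-1}),$$ where $(w_{k+1})_{k\ge0}$ are random vectors in $\mathbb R^d$ on a probability space. Let $\mathcal F_k=\sigma(x_0,\dots,x_k)$ and assume that, for some $\sigma>0$ and all $k\ge 0$, $w_{k+1}$ is $\mathcal F_{k+1}$-measurable and, for all $t\ge0$, $\mathbb P(\|w_{k+1}\|\ge t\mid\mathcal F_k)\le 2e^{-t^2/(2\sigma^2)}$ almost surely. For $\theta>0$ put $$R_K(\theta)=\frac{2\sigma^2}{(K+1)\theta}\log\mathbb E\Bigl[e^{\frac{\theta}{2\sigma^2}S_K}\Bigr]\in(-\infty,+\infty],\qquad S_K=\sum_{k=0}^K\bigl(f(x_k)-f_*\bigr),\qquad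 R(\theta)=\limsup_{K\to\infty}R_K(\theta),$$ and $\bar x_K=\frac1{K+1}\sum_{k=0}^Kx_k$. **Premise.** Let $\rho_0,\rho_1,\rho_2,\rho_3\in[0,1)$, $a,b,c_0,c_1\ge0$, and let $\tilde P\in\mathbb R^{2\times2}$ be symmetric positive semidefinite. Put $$p=\rho_0^2+c_1\rho_1^2+\rho_2^2+\frac{4b(1+\nu)^2L^2}{\mu}\mathbf 1_{\{c_1>0\}},\quad q=\rho_3^2+\frac{4b\nu^2L^2}{\mu}\mathbf 1_{\{c_1>0\}},\quad r=a+\alpha^2\Bigl(\frac{c_1L}{2}+\tilde P_{11}\Bigr),$$ $\tilde r=\tilde P_{11}-\tilde P_{12}^2/\tilde P_{22}$ if $\tilde P_{22}\ne0$ and $\tilde r=\tilde P_{11}$ otherwise, and $D=c_1+\frac2L\tilde r$. Assume $p+q<1$, $D>0$, $c_1+\tilde P_{11}>0$ and $$\tilde M_2+c_1\tilde M_1+c_0\tilde M_0\succeq0 .$$ Here, with $\tilde A=\begin{bmatrix}1+\beta&-\beta\\1&0\end{bmatrix}$, $\tilde B=\begin{bmatrix}-\alpha\\0\end{bmatrix}$,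 $\tilde C=\begin{bmatrix}1+\nu&-\nu\end{bmatrix}$ and $\Delta=\beta-\nu$, the symmetric $4\times4$ matrices are $$\tilde M_0=\begin{bmatrix}2\mu L\tilde C^\top\tilde C&-(\mu+L)\tilde C^\top&0\\-(\mu+L)\tilde C&2&0\\0&0&0\end{bmatrix},\qquad \tilde M_2=\begin{bmatrix}-\tilde A^\top\tilde P\tilde A+\rho_0^2\tilde P&-\tilde A^\top\tilde P\tilde B&-\tilde A^\top\tilde P\tilde B\\-\tilde B^\top\tilde P\tilde A&-\tilde B^\top\tilde P\tilde B+bc_1&-\tilde B^\top\tilde P\tilde B\\-\tilde B^\top\tilde P\tilde A&-\tilde B^\top\tilde P\tilde B&a\end{bmatrix},$$ $$\tilde M_1=\begin{bmatrix}\tilde X_1+\rho_0^2\tilde X_2+(1-\rho_0^2)\tilde X_3+\tilde Z&h\\h^\top&0\end{bmatrix},\qquad h=\begin{bmatrix}\tfrac{L\alpha\Delta}2&-\tfrac{L\alpha\Delta}2&\tfrac{\alpha(1-L\alpha)}2\end{bmatrix}^\top,$$ $$\tilde X_1=\tfrac12\begin{bmatrix}-L\Delta^2&L\Delta^2&-(1-\alpha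 L)\Delta\\L\Delta^2&-L\Delta^2&(1-\alpha L)\Delta\\-(1-\alpha L)\Delta&(1-\alpha L)\Delta&\alpha(2-L\alpha)\end{bmatrix},\qquad \tilde X_2=\tfrac12\begin{bmatrix}\nu^2\mu&-\nu^2\mu&-\nu\\-\nu^2\mu&\nu^2\mu&\nu\\-\nu&\nu&0\end{bmatrix},$$ $$\tilde X_3=\tfrac12\begin{bmatrix}(1+\nu)^2\mu&-\nu(1+\nu)\mu&-(1+\nu)\\-\nu(1+\nu)\mu&\nu^2\mu&\nu\\-(1+\nu)&\nu&0\end{bmatrix},\qquad \tilde Z=\begin{bmatrix}\rho_1^2\tilde P_{11}+\frac\mu2\rho_2^2&\rho_1^2\tilde P_{12}&0\\\rho_1^2\tilde P_{12}&\rho_1^2\tilde P_{22}+\frac\mu2\rho_3^2&0\\0&0&0\end{bmatrix}.$$ **Bounds.** Put $$\overline H_\infty=\Bigl(\frac1{1-(p+q)}\cdot\frac rD\Bigr)^{1/2},\qquad\lambda_+=\frac{p+\sqrt{p^2+4q}}2,\qquad J=\frac1{1+\lambda_+-p},\qquad a_{j,K}=\frac{1-\lambda_+^{K-j+1}}{1-(p+q)},$$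 $$V_0=c_1\bigl(f(x_0)-f_*\bigr)+\bigl(\tilde P_{11}+2\tilde P_{12}+\tilde P_{22}\bigr)\|x_0-x_*\|^2,\qquad \bar c(K,\theta)=\Bigl(\frac{1-\lambda_+^{K+1}}{1-\lambda_+}-1+J\Bigr)V_0+\hat c(K,\theta),$$ where $\hat c(K,\theta)=\frac{2\sigma^2D}{\theta}\sum_{j=1}^K\log\frac{D+r\theta a_{j,K}}{D-r\theta a_{j,K}}$ if $\sqrt\theta\,\overline H_\infty<1$ and $\hat c(K,\theta)=+\infty$ otherwise. Let $$\overline R_K(\theta)=\frac1{D(K+1)}\min\Bigl\{\frac1J\,\bar c\Bigl(K,\frac\theta J\Bigr),\ \bar c(K+1,\theta)\Bigr\}\quad\text{if }\sqrt\theta\,\overline H_\infty<1,\qquad \overline R_K(\theta)=+\infty\quad\text{otherwise},$$ and $\overline R(\theta)=\limsup_{K\to\infty}\overline R_K(\theta)$. **Claim.** For every $\theta>0$, $$R(\theta)\le\overline R(\theta)=\begin{cases}\dfrac{2\sigma^2}\theta\log\dfrac{1+\theta\,\overline H_\infty^2}{1-\theta\,\overline H_\infty^2},&\sqrt\theta\,\overline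 H_\infty<1,\\[2mm]+\infty,&\text{otherwise.}\end{cases}$$ Furthermore, $f(\bar x_K)-f_*$ is integrable for every $K$, and $$\limsup_{K\to\infty}\mathbb E\bigl[f(\bar x_K)-f_*\bigr]\le\lim_{\theta\downarrow0}\overline R(\theta)=4\sigma^2\,\overline H_\infty^2 .$$ -/

import Mathlib

open MeasureTheory ProbabilityTheory Filter Topology

noncomputable section

namespace GMM

/-- The class `C_μ^L(ℝᵈ)`: `μ`-strongly convex, continuously differentiable functions whose gradient
is `L`-Lipschitz. -/
structure SmoothStronglyConvex {d : ℕ} (μ L : ℝ) (f : EuclideanSpace ℝ (Fin d) → ℝ) : Prop where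
  contDiff : ContDiff ℝ 1 f
  strongConvex : StrongConvexOn Set.univ μ f
  lipschitz_gradient : ∀ x y, ‖gradient f x - gradient f y‖ ≤ L * ‖x - y‖

/-- Step size `α` and momentum parameters `β`, `ν` of the generalized momentum method. -/
structure Params where
  α : ℝ
  β : ℝ
  ν : ℝ

/-! ### The noisy iteration -/

/-- The pair `(x_k, x_{k-1})` produced from `x_0 = x_{-1} = x0` by
`x_{k+1} = x_k - α (∇f(y_k) + w_{k+1}) + β (x_k - x_{k-1})`, `y_k = x_k + ν (x_k - x_{k-1})`,
for the gradient errors `w 1, w 2, …` (the value `w 0` is not used). -/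
def state {d : ℕ} (f : EuclideanSpace ℝ (Fin d) → ℝ) (m : Params)
    (x0 : EuclideanSpace ℝ (Fin d)) (w : ℕ → EuclideanSpace ℝ (Fin d)) :
    ℕ → EuclideanSpace ℝ (Fin d) × EuclideanSpace ℝ (Fin d)
  | 0 => (x0, x0)
  | k + 1 =>
    let x := (state f m x0 w k).1
    let xprev := (state f m x0 w k).2
    let y := x + m.ν • (x - xprev)
    (x - m.α • (gradient f y + w (k + 1)) + m.β • (x - xprev), x)

/-- The random iterate `x_k` driven by the random gradient errors `w`. -/
def iterate {d : ℕ} {Ω : Type*} (f : EuclideanSpace ℝ (Fin d) → ℝ) (m : Params)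
    (x0 : EuclideanSpace ℝ (Fin d)) (w : ℕ → Ω → EuclideanSpace ℝ (Fin d)) (k : ℕ) (ω : Ω) :
    EuclideanSpace ℝ (Fin d) :=
  (state f m x0 (fun j => w j ω) k).1

/-- The averaged iterate `(x_0 + ⋯ + x_K) / (K + 1)`. -/
def averagedIterate {d : ℕ} {Ω : Type*} (f : EuclideanSpace ℝ (Fin d) → ℝ) (m : Params)
    (x0 : EuclideanSpace ℝ (Fin d)) (w : ℕ → Ω → EuclideanSpace ℝ (Fin d)) (K : ℕ) (ω : Ω) :
    EuclideanSpace ℝ (Fin d) :=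
  ((K : ℝ) + 1)⁻¹ • ∑ k ∈ Finset.range (K + 1), iterate f m x0 w k ω

/-- `F_k`, the `σ`-algebra generated by `x_0, …, x_k`. -/
@[reducible] def history {d : ℕ} {Ω : Type*} (f : EuclideanSpace ℝ (Fin d) → ℝ) (m : Params)
    (x0 : EuclideanSpace ℝ (Fin d)) (w : ℕ → Ω → EuclideanSpace ℝ (Fin d)) (k : ℕ) :
    MeasurableSpace Ω :=
  ⨆ j ∈ Finset.range (k + 1), MeasurableSpace.comap (iterate f m x0 w j) inferInstance

/-- The noise model: the gradient errors are random vectors, adapted to the filtration generated by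
the iterates, and `‖w_{k+1}‖` is sub-Gaussian conditionally on `F_k` with variance proxy `σ²`.
The noise may be biased. -/
structure SubGaussianNoise {d : ℕ} {Ω : Type*} [MeasurableSpace Ω] (Pr : Measure Ω)
    (f : EuclideanSpace ℝ (Fin d) → ℝ) (m : Params) (x0 : EuclideanSpace ℝ (Fin d))
    (w : ℕ → Ω → EuclideanSpace ℝ (Fin d)) (σ : ℝ) : Prop where
  measurable : ∀ k, Measurable (w (k + 1))
  adapted : ∀ k, Measurable[history f m x0 w (k + 1)] (w (k + 1))
  tail : ∀ k, ∀ t : ℝ, 0 ≤ t →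
    ∀ᵐ ω ∂Pr, (Pr⟦{ω | t ≤ ‖w (k + 1) ω‖} | history f m x0 w k⟧) ω
      ≤ 2 * Real.exp (-t ^ 2 / (2 * σ ^ 2))

/-! ### Risk-sensitive cost and risk-sensitive index -/

/-- The cumulative suboptimality `S_K = ∑_{k=0}^K (f(x_k) - fstar)`. -/
def cumulativeSubopt {d : ℕ} {Ω : Type*} (f : EuclideanSpace ℝ (Fin d) → ℝ) (fstar : ℝ)
    (m : Params) (x0 : EuclideanSpace ℝ (Fin d)) (w : ℕ → Ω → EuclideanSpace ℝ (Fin d))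
    (K : ℕ) (ω : Ω) : ℝ :=
  ∑ k ∈ Finset.range (K + 1), (f (iterate f m x0 w k ω) - fstar)

/-- `R_K(θ) = 2σ² / ((K+1) θ) * log E[exp(θ S_K / (2σ²))]`, with value `+∞` when the expectation is
infinite. -/
def riskCost {d : ℕ} {Ω : Type*} [MeasurableSpace Ω] (Pr : Measure Ω)
    (f : EuclideanSpace ℝ (Fin d) → ℝ) (fstar : ℝ) (m : Params)
    (x0 : EuclideanSpace ℝ (Fin d)) (w : ℕ → Ω → EuclideanSpace ℝ (Fin d)) (σ θ : ℝ) (K : ℕ) :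
    EReal :=
  ((2 * σ ^ 2 / (((K : ℝ) + 1) * θ) : ℝ) : EReal) *
    ENNReal.log (∫⁻ ω, ENNReal.ofReal
      (Real.exp (θ / (2 * σ ^ 2) * cumulativeSubopt f fstar m x0 w K ω)) ∂Pr)

/-- The risk-sensitive index `R(θ) = limsup_K R_K(θ)`. -/
def riskIndex {d : ℕ} {Ω : Type*} [MeasurableSpace Ω] (Pr : Measure Ω)
    (f : EuclideanSpace ℝ (Fin d) → ℝ) (fstar : ℝ) (m : Params)
    (x0 : EuclideanSpace ℝ (Fin d)) (w : ℕ → Ω → EuclideanSpace ℝ (Fin d)) (σ θ : ℝ) : EReal :=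
  limsup (fun K => riskCost Pr f fstar m x0 w σ θ K) atTop

/-! ### The matrix inequality -/

/-- The matrix `Ã`. -/
def matA (m : Params) : Matrix (Fin 2) (Fin 2) ℝ := !![1 + m.β, -m.β; 1, 0]

/-- The matrix `B̃`. -/
def matB (m : Params) : Matrix (Fin 2) (Fin 1) ℝ := !![-m.α; 0]

/-- The matrix `C̃`. -/
def matC (m : Params) : Matrix (Fin 1) (Fin 2) ℝ := !![1 + m.ν, -m.ν]

/-- The unknowns of the matrix inequality. -/
structure Certificate where
  ρ₀ : ℝ
  ρ₁ : ℝ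
  ρ₂ : ℝ
  ρ₃ : ℝ
  a : ℝ
  b : ℝ
  c₀ : ℝ
  c₁ : ℝ
  /-- The `2 × 2` matrix `P̃`. -/
  P : Matrix (Fin 2) (Fin 2) ℝ

namespace Certificate

/-- `M̃₀`, in the variables `(x_k - x_*, x_{k-1} - x_*, ∇f(y_k), w_{k+1})` like all the `4 × 4`
matrices below. -/
def M0 (μ L : ℝ) (m : Params) : Matrix (Fin 4) (Fin 4) ℝ :=
  let T : Matrix (Fin 2) (Fin 2) ℝ := (2 * μ * L) • ((matC m).transpose * matC m)
  let u : Matrix (Fin 2) (Fin 1) ℝ := (-(μ + L)) • (matC m).transpose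
  !![T 0 0, T 0 1, u 0 0, 0;
     T 1 0, T 1 1, u 1 0, 0;
     u 0 0, u 1 0, 2,     0;
     0,     0,     0,     0]

/-- `X̃₁`, where `Δ̃ = β - ν`. -/
def X1 (L : ℝ) (m : Params) : Matrix (Fin 3) (Fin 3) ℝ :=
  let Δ := m.β - m.ν
  (1 / 2 : ℝ) •
    !![-L * Δ ^ 2,             L * Δ ^ 2,             -(1 - m.α * L) * Δ;
       L * Δ ^ 2,              -L * Δ ^ 2,            (1 - L * m.α) * Δ;
       -(1 - m.α * L) * Δ,     (1 - L * m.α) * Δ,     m.α * (2 - L * m.α)]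

/-- `X̃₂`. -/
def X2 (μ : ℝ) (m : Params) : Matrix (Fin 3) (Fin 3) ℝ :=
  (1 / 2 : ℝ) •
    !![m.ν ^ 2 * μ,  -m.ν ^ 2 * μ, -m.ν;
       -m.ν ^ 2 * μ, m.ν ^ 2 * μ,  m.ν;
       -m.ν,         m.ν,          0]

/-- `X̃₃`. -/
def X3 (μ : ℝ) (m : Params) : Matrix (Fin 3) (Fin 3) ℝ :=
  (1 / 2 : ℝ) •
    !![(1 + m.ν) ^ 2 * μ,      -m.ν * (1 + m.ν) * μ, -(1 + m.ν);
       -m.ν * (1 + m.ν) * μ,   m.ν ^ 2 * μ,          m.ν;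
       -(1 + m.ν),             m.ν,                  0]

/-- `X̃ = X̃₁ + ρ₀² X̃₂ + (1 - ρ₀²) X̃₃`. -/
def X (c : Certificate) (μ L : ℝ) (m : Params) : Matrix (Fin 3) (Fin 3) ℝ :=
  X1 L m + c.ρ₀ ^ 2 • X2 μ m + (1 - c.ρ₀ ^ 2) • X3 μ m

/-- `Z̃`. -/
def Z (c : Certificate) (μ : ℝ) : Matrix (Fin 3) (Fin 3) ℝ :=
  !![c.ρ₁ ^ 2 * c.P 0 0 + μ / 2 * c.ρ₂ ^ 2, c.ρ₁ ^ 2 * c.P 0 1,                    0;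
     c.ρ₁ ^ 2 * c.P 0 1,                    c.ρ₁ ^ 2 * c.P 1 1 + μ / 2 * c.ρ₃ ^ 2, 0;
     0,                                     0,                                     0]

/-- `M̃₁`. -/
def M1 (c : Certificate) (μ L : ℝ) (m : Params) : Matrix (Fin 4) (Fin 4) ℝ :=
  let Y : Matrix (Fin 3) (Fin 3) ℝ := X c μ L m + Z c μ
  let h : ℝ := L * m.α * (m.β - m.ν) / 2
  let g : ℝ := m.α * (1 - L * m.α) / 2
  !![Y 0 0, Y 0 1, Y 0 2, h;
     Y 1 0, Y 1 1, Y 1 2, -h;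
     Y 2 0, Y 2 1, Y 2 2, g;
     h,     -h,    g,     0]

/-- `M̃₂(P̃, a)`. -/
def M2 (c : Certificate) (m : Params) : Matrix (Fin 4) (Fin 4) ℝ :=
  let N : Matrix (Fin 2) (Fin 2) ℝ := -((matA m).transpose * c.P * matA m) + c.ρ₀ ^ 2 • c.P
  let u : Matrix (Fin 2) (Fin 1) ℝ := -((matA m).transpose * c.P * matB m)
  let u' : Matrix (Fin 1) (Fin 2) ℝ := -((matB m).transpose * c.P * matA m)
  let s : ℝ := -((matB m).transpose * c.P * matB m) 0 0
  !![N 0 0,  N 0 1,  u 0 0,          u 0 0;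
     N 1 0,  N 1 1,  u 1 0,          u 1 0;
     u' 0 0, u' 0 1, s + c.b * c.c₁, s;
     u' 0 0, u' 0 1, s,              c.a]

/-- The indicator of `c₁ > 0` (only `c₁ ≥ 0` is used). The entry `b c₁` of `M̃₂` contributes
`b c₁ ‖∇f(y_k)‖²`, where `c₁ (f - f_*)` is bounded by the Lyapunov function; so the weight of `b` in
`p` and `q` is `1` when `c₁ > 0`, and `0` when `c₁ = 0`. -/
def switch (c : Certificate) : ℝ := if c.c₁ = 0 then 0 else 1

/-- `p = ρ₀² + c₁ ρ₁² + ρ₂² + (4 b (1+ν)² L² / μ) 1_{c₁ > 0}`. -/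
def p (c : Certificate) (μ L : ℝ) (m : Params) : ℝ :=
  c.ρ₀ ^ 2 + c.c₁ * c.ρ₁ ^ 2 + c.ρ₂ ^ 2 + 4 * c.b * (1 + m.ν) ^ 2 * L ^ 2 / μ * c.switch

/-- `q = ρ₃² + (4 b ν² L² / μ) 1_{c₁ > 0}`. -/
def q (c : Certificate) (μ L : ℝ) (m : Params) : ℝ :=
  c.ρ₃ ^ 2 + 4 * c.b * m.ν ^ 2 * L ^ 2 / μ * c.switch

/-- `r = a + α² (c₁ L / 2 + P̃₁₁)`. -/
def r (c : Certificate) (L : ℝ) (m : Params) : ℝ :=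
  c.a + m.α ^ 2 * (c.c₁ * L / 2 + c.P 0 0)

/-- `r̃(P̃)`. -/
def rTilde (c : Certificate) : ℝ :=
  if c.P 1 1 ≠ 0 then c.P 0 0 - c.P 0 1 ^ 2 / c.P 1 1 else c.P 0 0

/-- The constant `c₁ + (2 / L) r̃(P̃)`. -/
def denom (c : Certificate) (L : ℝ) : ℝ := c.c₁ + 2 / L * c.rTilde

/-- The conditions on the scalars, on `P̃`, and the matrix inequality. -/
structure Feasible (c : Certificate) (μ L : ℝ) (m : Params) : Prop where
  ρ₀_mem : c.ρ₀ ∈ Set.Ico (0 : ℝ) 1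
  ρ₁_mem : c.ρ₁ ∈ Set.Ico (0 : ℝ) 1
  ρ₂_mem : c.ρ₂ ∈ Set.Ico (0 : ℝ) 1
  ρ₃_mem : c.ρ₃ ∈ Set.Ico (0 : ℝ) 1
  a_nonneg : 0 ≤ c.a
  b_nonneg : 0 ≤ c.b
  c₀_nonneg : 0 ≤ c.c₀
  c₁_nonneg : 0 ≤ c.c₁
  P_posSemidef : c.P.PosSemidef
  p_add_q_lt_one : c.p μ L m + c.q μ L m < 1
  denom_pos : 0 < c.denom L
  c₁_add_P_pos : 0 < c.c₁ + c.P 0 0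
  matrix_inequality : (c.M2 m + c.c₁ • c.M1 μ L m + c.c₀ • M0 μ L m).PosSemidef

/-- The upper bound `H̄_∞` on the `H_∞`-norm. -/
def Hbar (c : Certificate) (μ L : ℝ) (m : Params) : ℝ :=
  Real.sqrt (1 / (1 - (c.p μ L m + c.q μ L m)) * (c.r L m / c.denom L))

/-! ### The finite-horizon bound -/

/-- `λ₊ = (p + √(p² + 4 q)) / 2`. -/
def lamPlus (c : Certificate) (μ L : ℝ) (m : Params) : ℝ :=
  (c.p μ L m + Real.sqrt (c.p μ L m ^ 2 + 4 * c.q μ L m)) / 2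

/-- `J_{p,q} = 1 / (1 + λ₊ - p)`. -/
def J (c : Certificate) (μ L : ℝ) (m : Params) : ℝ :=
  1 / (1 + c.lamPlus μ L m - c.p μ L m)

/-- `a_{j,K} = (1 - λ₊^{K-j+1}) / (1 - (p+q))`, used for `1 ≤ j ≤ K` only. -/
def aCoef (c : Certificate) (μ L : ℝ) (m : Params) (j K : ℕ) : ℝ :=
  (1 - c.lamPlus μ L m ^ (K - j + 1)) / (1 - (c.p μ L m + c.q μ L m))

/-- The Lyapunov function `V_{P,c₁}` at the state `(x, xprev)`, with `P = P̃ ⊗ I_d`. -/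
def lyapunov {d : ℕ} (c : Certificate) (f : EuclideanSpace ℝ (Fin d) → ℝ)
    (xstar x xprev : EuclideanSpace ℝ (Fin d)) : ℝ :=
  c.c₁ * (f x - f xstar) +
    (c.P 0 0 * inner ℝ (x - xstar) (x - xstar) + c.P 0 1 * inner ℝ (x - xstar) (xprev - xstar) +
      c.P 1 0 * inner ℝ (xprev - xstar) (x - xstar) +
      c.P 1 1 * inner ℝ (xprev - xstar) (xprev - xstar))

/-- `ĉ(K, θ)`. -/
def cHat (c : Certificate) (μ L : ℝ) (m : Params) (σ : ℝ) (K : ℕ) (θ : ℝ) : EReal :=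
  if Real.sqrt θ * c.Hbar μ L m < 1 then
    ((2 * σ ^ 2 * c.denom L / θ * ∑ j ∈ Finset.Icc 1 K,
      Real.log ((c.denom L + c.r L m * θ * c.aCoef μ L m j K) /
        (c.denom L - c.r L m * θ * c.aCoef μ L m j K)) : ℝ) : EReal)
  else ⊤

/-- `c̄(K, θ)`, where `V0` is the value of the Lyapunov function at the initial state. -/
def cBar (c : Certificate) (μ L : ℝ) (m : Params) (σ V0 : ℝ) (K : ℕ) (θ : ℝ) : EReal :=
  ((((1 - c.lamPlus μ L m ^ (K + 1)) / (1 - c.lamPlus μ L m) - 1 + c.J μ L m) * V0 : ℝ) : EReal)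
    + c.cHat μ L m σ K θ

/-- The upper bound `R̄_K(θ)` on the risk-sensitive cost. -/
def riskCostBound (c : Certificate) (μ L : ℝ) (m : Params) (σ V0 θ : ℝ) (K : ℕ) : EReal :=
  if Real.sqrt θ * c.Hbar μ L m < 1 then
    ((1 / (c.denom L * ((K : ℝ) + 1)) : ℝ) : EReal) *
      min (((1 / c.J μ L m : ℝ) : EReal) * c.cBar μ L m σ V0 K (θ / c.J μ L m))
        (c.cBar μ L m σ V0 (K + 1) θ)
  else ⊤

/-- `R̄(θ) = limsup_K R̄_K(θ)`. -/
def riskIndexBound (c : Certificate) (μ L : ℝ) (m : Params) (σ V0 θ : ℝ) : EReal :=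
  limsup (fun K => c.riskCostBound μ L m σ V0 θ K) atTop

end Certificate

end GMM

end

/-!
The proof reduces the risk of the iterates to the energy of the gradient errors along each path, and
then uses only the conditional exponential moments of the errors.

Let `V_k` be the Lyapunov function at `(x_k, x_{k-1})`. The matrix inequality, evaluated at
`(x_k - x_*, x_{k-1} - x_*, ∇f(y_k), w_{k+1})` and combined with the descent lemma, strong convexity
and coercivity of the gradient, gives `V_{k+1} ≤ p V_k + q V_{k-1} + r ‖w_{k+1}‖²`
(`Feasible.lyapunov_step`). Summing this over `k` and using `D (f(x_k) - f_*) ≤ V_k`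
(`Feasible.denom_mul_sub_le_lyapunov`) yields the pathwise bound
`S_K ≤ C + H̄_∞² ∑_{j ≤ K} ‖w_j‖²` with a constant `C` (`Feasible.sum_sub_le`).

By the layer cake formula, the tail bound gives
`E[exp(s ‖w_{k+1}‖² / (2σ²)) | F_k] ≤ (1 + s) / (1 - s)` for `0 ≤ s < 1`. Here conditioning on `F_k`
is expressed by changing the measure with an `F_k`-measurable density. Iterating it
(`SubGaussianNoise.lintegral_exp_sum_le`) with `s = θ H̄_∞²` bounds `R_K(θ)` by
`(2σ²/θ) log((1 + s) / (1 - s)) + O(1/K)`. So the constants of the finite-horizon bound `R̄_K` play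
no role in the estimate of `R(θ)`. It only remains to see that `R̄_K(θ)` has the same limit: this is
a Cesàro limit, as `a_{j,K} → 1 / (1 - (p + q))` when `K - j → ∞`, and the other term of the minimum
is asymptotically no smaller because `J ≤ 1` (`Feasible.tendsto_riskCostBound`).

For the averaged iterate, the same tail bound gives `E ‖w_j‖² ≤ 4σ²`, which is inserted into the
pathwise bound after Jensen's inequality.
-/

namespace GMM

/-! ### Smooth strongly convex functions -/

section Convex

variable {d : ℕ} {μ L : ℝ} {f : EuclideanSpace ℝ (Fin d) → ℝ}

lemma SmoothStronglyConvex.hasDerivAt_lineMap (hf : SmoothStronglyConvex μ L f)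
    (x v : EuclideanSpace ℝ (Fin d)) (t : ℝ) :
    HasDerivAt (fun s : ℝ => f (x + s • v)) (inner ℝ (gradient f (x + t • v)) v) t := by
  have hd : DifferentiableAt ℝ f (x + t • v) :=
    (hf.contDiff.differentiable one_ne_zero).differentiableAt
  have h1 : HasFDerivAt f _ (x + t • v) := hd.hasGradientAt.hasFDerivAt
  have h2 : HasDerivAt (fun s : ℝ => x + s • v) v t := by
    simpa using ((hasDerivAt_id t).smul_const v).const_add x
  exact (h1.comp_hasDerivAt t h2).congr_deriv (by simp)

/-- The descent lemma: along a segment, `f` minus its quadratic upper model is antitone. -/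
lemma SmoothStronglyConvex.le_quadratic (hf : SmoothStronglyConvex μ L f)
    (x y : EuclideanSpace ℝ (Fin d)) :
    f y ≤ f x + inner ℝ (gradient f x) (y - x) + L / 2 * ‖y - x‖ ^ 2 := by
  set v := y - x with hv
  let ψ : ℝ → ℝ := fun t => f (x + t • v) - t * inner ℝ (gradient f x) v - L / 2 * ‖v‖ ^ 2 * t ^ 2
  have hψ : ∀ t, HasDerivAt ψ (inner ℝ (gradient f (x + t • v)) v - inner ℝ (gradient f x) v
      - L * ‖v‖ ^ 2 * t) t := by
    intro t
    have := ((hf.hasDerivAt_lineMap x v t).sub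
      ((hasDerivAt_id t).mul_const (inner ℝ (gradient f x) v))).sub
      (((hasDerivAt_pow 2 t)).const_mul (L / 2 * ‖v‖ ^ 2))
    refine this.congr_deriv ?_
    simp
    ring
  have hanti : AntitoneOn ψ (Set.Icc 0 1) := by
    refine antitoneOn_of_hasDerivWithinAt_nonpos (convex_Icc 0 1)
      (fun t _ => (hψ t).continuousAt.continuousWithinAt)
      (fun t _ => (hψ t).hasDerivWithinAt) ?_
    intro t ht
    rw [interior_Icc] at ht
    have h1 : inner ℝ (gradient f (x + t • v) - gradient f x) v ≤ L * ‖t • v‖ * ‖v‖ := by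
      refine (real_inner_le_norm _ _).trans ?_
      gcongr
      simpa using hf.lipschitz_gradient (x + t • v) x
    rw [inner_sub_left, norm_smul, Real.norm_of_nonneg ht.1.le] at h1
    nlinarith
  have := hanti (Set.left_mem_Icc.2 zero_le_one) (Set.right_mem_Icc.2 zero_le_one) zero_le_one
  simp only [ψ, one_smul, zero_smul, add_zero] at this
  rw [hv, add_sub_cancel, ← hv] at this
  linarith

lemma SmoothStronglyConvex.quadratic_le (hf : SmoothStronglyConvex μ L f)
    (x y : EuclideanSpace ℝ (Fin d)) :
    f x + inner ℝ (gradient f x) (y - x) + μ / 2 * ‖y - x‖ ^ 2 ≤ f y := by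
  have h0 := hf.hasDerivAt_lineMap x (y - x) 0
  simp only [zero_smul, add_zero] at h0
  -- the difference quotients at `x` are bounded by `f y - f x - (1 - t) μ / 2 ‖y - x‖²`
  have h1 := h0.tendsto_slope_zero_right
  have h2 : Tendsto (fun t : ℝ => f y - f x - (1 - t) * (μ / 2 * ‖y - x‖ ^ 2)) (𝓝[>] 0)
      (𝓝 (f y - f x - (1 - 0) * (μ / 2 * ‖y - x‖ ^ 2))) := by
    refine Tendsto.mono_left (Continuous.tendsto ?_ 0) nhdsWithin_le_nhds
    fun_prop
  have h3 := le_of_tendsto_of_tendsto h1 h2 ?_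
  · linarith
  · filter_upwards [Ioo_mem_nhdsGT (zero_lt_one' ℝ)] with t ht
    have := hf.strongConvex.2 (Set.mem_univ x) (Set.mem_univ y) (sub_nonneg.2 ht.2.le) ht.1.le
      (by ring)
    have e : (1 - t) • x + t • y = x + t • (y - x) := by
      rw [smul_sub, sub_smul, one_smul]; abel
    rw [e, norm_sub_rev x y] at this
    simp only [smul_eq_mul, zero_add, zero_smul, add_zero] at this ⊢
    rw [inv_mul_le_iff₀ ht.1]
    linarith

variable {xstar : EuclideanSpace ℝ (Fin d)}

lemma SmoothStronglyConvex.gradient_eq_zero (hf : SmoothStronglyConvex μ L f)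
    (hxstar : ∀ x, f xstar ≤ f x) : gradient f xstar = 0 := by
  have h := hf.hasDerivAt_lineMap xstar (gradient f xstar) 0
  have hmin : IsLocalMin (fun s : ℝ => f (xstar + s • gradient f xstar)) 0 :=
    Eventually.of_forall fun s => by simpa using hxstar _
  have := hmin.hasDerivAt_eq_zero h
  simpa using this

lemma SmoothStronglyConvex.sub_le_sq (hf : SmoothStronglyConvex μ L f)
    (hxstar : ∀ x, f xstar ≤ f x) (x : EuclideanSpace ℝ (Fin d)) :
    f x - f xstar ≤ L / 2 * ‖x - xstar‖ ^ 2 := by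
  have := hf.le_quadratic xstar x
  rw [hf.gradient_eq_zero hxstar, inner_zero_left] at this
  linarith

lemma SmoothStronglyConvex.sq_le_sub (hf : SmoothStronglyConvex μ L f)
    (hxstar : ∀ x, f xstar ≤ f x) (x : EuclideanSpace ℝ (Fin d)) :
    μ / 2 * ‖x - xstar‖ ^ 2 ≤ f x - f xstar := by
  have := hf.quadratic_le xstar x
  rw [hf.gradient_eq_zero hxstar, inner_zero_left] at this
  linarith

/-- Coercivity of the gradient at the minimizer: the sector condition behind `M̃₀`. It compares the
lower model at one of the points `xstar`, `y` with the upper model at the other one, at the minimizer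
of their difference. -/
lemma SmoothStronglyConvex.inner_gradient_ge (hμL : μ < L) (hf : SmoothStronglyConvex μ L f)
    (hxstar : ∀ x, f xstar ≤ f x) (y : EuclideanSpace ℝ (Fin d)) :
    μ * L * ‖y - xstar‖ ^ 2 + ‖gradient f y‖ ^ 2
      ≤ (μ + L) * inner ℝ (y - xstar) (gradient f y) := by
  set v := y - xstar with hv
  set g := gradient f y with hg
  set u := (L - μ)⁻¹ • (g - μ • v) with hu
  have hl : 0 < L - μ := sub_pos.2 hμL
  have hgu : g = (L - μ) • u + μ • v := by
    rw [hu, smul_smul, mul_inv_cancel₀ hl.ne', one_smul, sub_add_cancel]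
  have a1 := hf.quadratic_le xstar (y - u)
  have a2 := hf.le_quadratic y (y - u)
  have b1 := hf.quadratic_le y (xstar + u)
  have b2 := hf.le_quadratic xstar (xstar + u)
  rw [hf.gradient_eq_zero hxstar, inner_zero_left] at a1 b2
  have e1 : y - u - xstar = v - u := by rw [hv]; abel
  have e2 : y - u - y = -u := by abel
  have e3 : xstar + u - y = u - v := by rw [hv]; abel
  have e4 : xstar + u - xstar = u := by abel
  rw [e1] at a1
  rw [e2] at a2
  rw [e3] at b1
  rw [e4] at b2
  rw [← hg] at a2 b1
  rw [← real_inner_self_eq_norm_sq] at *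
  rw [← real_inner_self_eq_norm_sq]
  simp only [hgu, inner_add_left, inner_add_right, inner_sub_left, inner_sub_right, inner_neg_right,
    inner_neg_left, real_inner_smul_left, real_inner_smul_right, real_inner_comm u v] at *
  nlinarith

lemma SmoothStronglyConvex.norm_gradient_le (hf : SmoothStronglyConvex μ L f)
    (hxstar : ∀ x, f xstar ≤ f x) (y : EuclideanSpace ℝ (Fin d)) :
    ‖gradient f y‖ ≤ L * ‖y - xstar‖ := by
  simpa [hf.gradient_eq_zero hxstar] using hf.lipschitz_gradient y xstar

end Convex

/-! ### The Lyapunov recursion -/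

lemma posSemidef_sum_inner_nonneg {n d : ℕ} {M : Matrix (Fin n) (Fin n) ℝ} (hM : M.PosSemidef)
    (v : Fin n → EuclideanSpace ℝ (Fin d)) : 0 ≤ ∑ i, ∑ j, M i j * inner ℝ (v i) (v j) := by
  have h : ∑ i, ∑ j, M i j * inner ℝ (v i) (v j)
      = ∑ k, ∑ i, ∑ j, v i k * (M i j * v j k) := by
    simp only [PiLp.inner_apply, Finset.mul_sum]
    rw [Finset.sum_comm' (t' := Finset.univ) (s' := fun _ => Finset.univ) (by simp)]
    conv_rhs => rw [Finset.sum_comm]; enter [2, i]; rw [Finset.sum_comm]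
    rw [Finset.sum_comm]
    refine Finset.sum_congr rfl fun i _ => Finset.sum_congr rfl fun j _ =>
      Finset.sum_congr rfl fun k _ => ?_
    simp
    ring
  rw [h]
  refine Finset.sum_nonneg fun k _ => ?_
  have := hM.dotProduct_mulVec_nonneg (fun i => v i k)
  simpa [dotProduct, Matrix.mulVec, Finset.mul_sum] using this

namespace Certificate

variable {d : ℕ} {μ L : ℝ} {f : EuclideanSpace ℝ (Fin d) → ℝ} {xstar : EuclideanSpace ℝ (Fin d)}
  {m : Params} {c : Certificate}

lemma Feasible.P_symm (hc : c.Feasible μ L m) : c.P 1 0 = c.P 0 1 := by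
  simpa using hc.P_posSemidef.isHermitian.apply 0 1

/-- The quadratic form of `P̃ ⊗ I_d`. -/
noncomputable def quad (c : Certificate) (u v : EuclideanSpace ℝ (Fin d)) : ℝ :=
  c.P 0 0 * inner ℝ u u + c.P 0 1 * inner ℝ u v + c.P 1 0 * inner ℝ v u + c.P 1 1 * inner ℝ v v

lemma Feasible.quad_nonneg (hc : c.Feasible μ L m) (u v : EuclideanSpace ℝ (Fin d)) :
    0 ≤ c.quad u v := by
  have := posSemidef_sum_inner_nonneg hc.P_posSemidef ![u, v]
  simp only [Fin.sum_univ_two, Matrix.cons_val_zero, Matrix.cons_val_one] at this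
  unfold quad
  linarith

/-- What the matrix inequality says at `(x - xstar, xprev - xstar, ∇f(y), w)`, before the terms in
`‖∇f(y)‖²` and in the previous iterates are bounded by the Lyapunov function. The blocks `X̃₁`, `X̃₂`,
`X̃₃` come from the descent lemma between `y` and the new iterate, and from strong convexity at `y`
tested against `x` and `xstar`. The matrices `M̃₁` and `M̃₂` leave out the contributions
`α² L / 2` and `α² P̃₁₁` of the new iterate to the coefficient of `‖w‖²`; these enter through `r`. -/
lemma Feasible.lyapunov_le_of_matrix_inequality (hμL : μ < L) (hf : SmoothStronglyConvex μ L f)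
    (hxstar : ∀ x, f xstar ≤ f x) (hc : c.Feasible μ L m) (x xp w : EuclideanSpace ℝ (Fin d)) :
    c.lyapunov f xstar
        (x - m.α • (gradient f (x + m.ν • (x - xp)) + w) + m.β • (x - xp)) x
      ≤ c.ρ₀ ^ 2 * c.lyapunov f xstar x xp
        + c.c₁ * (c.ρ₁ ^ 2 * c.quad (x - xstar) (xp - xstar) + c.ρ₂ ^ 2 * (f x - f xstar)
          + c.ρ₃ ^ 2 * (f xp - f xstar))
        + c.b * c.c₁ * ‖gradient f (x + m.ν • (x - xp))‖ ^ 2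
        + c.r L m * ‖w‖ ^ 2 := by
  obtain ⟨u, rfl⟩ : ∃ u, x = u + xstar := ⟨x - xstar, by simp⟩
  obtain ⟨v, rfl⟩ : ∃ v, xp = v + xstar := ⟨xp - xstar, by simp⟩
  unfold lyapunov quad r
  simp only [add_sub_add_right_eq_sub]
  have hM := posSemidef_sum_inner_nonneg hc.matrix_inequality
    ![u, v, gradient f (u + xstar + m.ν • (u - v)), w]
  have h1 := hf.le_quadratic (u + xstar + m.ν • (u - v))
    (u + xstar - m.α • (gradient f (u + xstar + m.ν • (u - v)) + w) + m.β • (u - v))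
  have h2 := hf.quadratic_le (u + xstar + m.ν • (u - v)) (u + xstar)
  have h3 := hf.quadratic_le (u + xstar + m.ν • (u - v)) xstar
  have h4 := hf.inner_gradient_ge hμL hxstar (u + xstar + m.ν • (u - v))
  have h5 := hf.sq_le_sub hxstar (u + xstar)
  have h6 := hf.sq_le_sub hxstar (v + xstar)
  generalize gradient f (u + xstar + m.ν • (u - v)) = g at *
  generalize f (u + xstar - m.α • (g + w) + m.β • (u - v)) = fn at *
  generalize f (u + xstar + m.ν • (u - v)) = fy at *
  have e1 : u + xstar - m.α • (g + w) + m.β • (u - v) - (u + xstar + m.ν • (u - v))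
      = (m.β - m.ν) • (u - v) - m.α • (g + w) := by module
  have e2 : u + xstar - (u + xstar + m.ν • (u - v)) = -m.ν • (u - v) := by module
  have e3 : xstar - (u + xstar + m.ν • (u - v)) = -(u + m.ν • (u - v)) := by module
  have e4 : u + xstar + m.ν • (u - v) - xstar = u + m.ν • (u - v) := by module
  have e5 : u + xstar - m.α • (g + w) + m.β • (u - v) - xstar
      = u - m.α • (g + w) + m.β • (u - v) := by module
  rw [e1] at h1
  rw [e2] at h2
  rw [e3] at h3
  rw [e4] at h4
  rw [e5]
  have nsq : ∀ z : EuclideanSpace ℝ (Fin d), ‖z‖ ^ 2 = inner ℝ z z :=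
    fun z => (real_inner_self_eq_norm_sq z).symm
  simp only [add_sub_cancel_right] at h5 h6 ⊢
  simp only [nsq] at h1 h2 h3 h4 h5 h6 ⊢
  simp [Fin.sum_univ_four, M0, M1, M2, X, X1, X2, X3, Z, matA, matB, matC, Matrix.mul_apply,
    Fin.sum_univ_two, hc.P_symm, Matrix.vecHead, Matrix.vecTail, real_inner_comm u v,
    real_inner_comm u g, real_inner_comm u w, real_inner_comm v g, real_inner_comm v w,
    real_inner_comm g w] at hM
  simp only [nsq] at hM
  have hP := hc.P_symm
  simp only [hP]
  generalize c.P 0 0 = p00 at *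
  generalize c.P 0 1 = p01 at *
  generalize c.P 1 1 = p11 at *
  simp only [inner_add_left, inner_add_right, inner_sub_left,
    inner_sub_right, inner_neg_right, inner_neg_left, real_inner_smul_left, real_inner_smul_right,
    real_inner_comm u v, real_inner_comm u g, real_inner_comm u w,
    real_inner_comm v g, real_inner_comm v w, real_inner_comm g w] at h1 h2 h3 h4 h5 h6 ⊢
  clear e1 e2 e3 e4 e5
  have hρ : 0 ≤ 1 - c.ρ₀ ^ 2 := by nlinarith [hc.ρ₀_mem.1, hc.ρ₀_mem.2]
  have k1 := mul_le_mul_of_nonneg_left h1 hc.c₁_nonneg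
  have k2 := mul_le_mul_of_nonneg_left h2 (mul_nonneg hc.c₁_nonneg (sq_nonneg c.ρ₀))
  have k3 := mul_le_mul_of_nonneg_left h3 (mul_nonneg hc.c₁_nonneg hρ)
  have k4 := mul_le_mul_of_nonneg_left h4 hc.c₀_nonneg
  have k5 := mul_le_mul_of_nonneg_left h5 (mul_nonneg hc.c₁_nonneg (sq_nonneg c.ρ₂))
  have k6 := mul_le_mul_of_nonneg_left h6 (mul_nonneg hc.c₁_nonneg (sq_nonneg c.ρ₃))
  clear h1 h2 h3 h4 h5 h6
  -- `M̃₀` is twice the sector condition, whence the weight of `k4`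
  linear_combination hM + k1 + k2 + k3 + 2 * k4 + k5 + k6
lemma Feasible.c₁_mul_sub_le_lyapunov (hc : c.Feasible μ L m) (x xp : EuclideanSpace ℝ (Fin d)) :
    c.c₁ * (f x - f xstar) ≤ c.lyapunov f xstar x xp := by
  have := hc.quad_nonneg (x - xstar) (xp - xstar)
  unfold quad at this
  unfold lyapunov
  linarith

lemma Feasible.lyapunov_nonneg (hxstar : ∀ x, f xstar ≤ f x) (hc : c.Feasible μ L m)
    (x xp : EuclideanSpace ℝ (Fin d)) : 0 ≤ c.lyapunov f xstar x xp :=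
  (mul_nonneg hc.c₁_nonneg (sub_nonneg.2 (hxstar x))).trans (hc.c₁_mul_sub_le_lyapunov x xp)

/-- `‖∇f(y)‖²` is bounded by the suboptimality of the two points that `y` extrapolates. -/
lemma _root_.GMM.SmoothStronglyConvex.norm_gradient_extrapolation_sq_le (hμ : 0 < μ)
    (hf : SmoothStronglyConvex μ L f) (hxstar : ∀ x, f xstar ≤ f x) (ν : ℝ)
    (x xp : EuclideanSpace ℝ (Fin d)) :
    ‖gradient f (x + ν • (x - xp))‖ ^ 2
      ≤ 4 * (1 + ν) ^ 2 * L ^ 2 / μ * (f x - f xstar)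
        + 4 * ν ^ 2 * L ^ 2 / μ * (f xp - f xstar) := by
  have hg := pow_le_pow_left₀ (norm_nonneg _) (hf.norm_gradient_le hxstar (x + ν • (x - xp))) 2
  have e : x + ν • (x - xp) - xstar = (1 + ν) • (x - xstar) - ν • (xp - xstar) := by module
  have hn : ‖x + ν • (x - xp) - xstar‖ ^ 2
      ≤ 2 * (1 + ν) ^ 2 * ‖x - xstar‖ ^ 2 + 2 * ν ^ 2 * ‖xp - xstar‖ ^ 2 := by
    have := parallelogram_law_with_norm ℝ ((1 + ν) • (x - xstar)) (ν • (xp - xstar))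
    simp only [norm_smul, Real.norm_eq_abs] at this
    rw [e]
    nlinarith [sq_nonneg ‖(1 + ν) • (x - xstar) + ν • (xp - xstar)‖, sq_abs (1 + ν), sq_abs ν]
  have h1 : ‖x - xstar‖ ^ 2 ≤ 2 / μ * (f x - f xstar) := by
    have := hf.sq_le_sub hxstar x
    rw [div_mul_eq_mul_div, le_div_iff₀ hμ]
    linarith
  have h2 : ‖xp - xstar‖ ^ 2 ≤ 2 / μ * (f xp - f xstar) := by
    have := hf.sq_le_sub hxstar xp
    rw [div_mul_eq_mul_div, le_div_iff₀ hμ]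
    linarith
  calc ‖gradient f (x + ν • (x - xp))‖ ^ 2
      ≤ L ^ 2 * ‖x + ν • (x - xp) - xstar‖ ^ 2 := by rwa [mul_pow] at hg
    _ ≤ L ^ 2 * (2 * (1 + ν) ^ 2 * (2 / μ * (f x - f xstar))
        + 2 * ν ^ 2 * (2 / μ * (f xp - f xstar))) := by
      refine mul_le_mul_of_nonneg_left (hn.trans ?_) (sq_nonneg L)
      gcongr
    _ = _ := by ring

/-- The two-step recursion `V_{k+1} ≤ p V_k + q V_{k-1} + r ‖w_{k+1}‖²`; of `V_{k-1}` it only uses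
that it bounds `c₁ (f(x_{k-1}) - f_*)`. -/
lemma Feasible.lyapunov_step (hμ : 0 < μ) (hμL : μ < L) (hf : SmoothStronglyConvex μ L f)
    (hxstar : ∀ x, f xstar ≤ f x) (hc : c.Feasible μ L m) (x xp w : EuclideanSpace ℝ (Fin d))
    {V : ℝ} (hV : c.c₁ * (f xp - f xstar) ≤ V) :
    c.lyapunov f xstar
        (x - m.α • (gradient f (x + m.ν • (x - xp)) + w) + m.β • (x - xp)) x
      ≤ c.p μ L m * c.lyapunov f xstar x xp + c.q μ L m * V + c.r L m * ‖w‖ ^ 2 := by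
  refine (hc.lyapunov_le_of_matrix_inequality hμL hf hxstar x xp w).trans ?_
  have hfx := sub_nonneg.2 (hxstar x)
  have hx : c.c₁ * (f x - f xstar) ≤ c.lyapunov f xstar x xp := hc.c₁_mul_sub_le_lyapunov x xp
  have hq : c.quad (x - xstar) (xp - xstar) ≤ c.lyapunov f xstar x xp := by
    have := mul_nonneg hc.c₁_nonneg hfx
    unfold quad lyapunov
    linarith
  have hg : c.b * c.c₁ * ‖gradient f (x + m.ν • (x - xp))‖ ^ 2
      ≤ 4 * c.b * (1 + m.ν) ^ 2 * L ^ 2 / μ * c.switch * c.lyapunov f xstar x xp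
        + 4 * c.b * m.ν ^ 2 * L ^ 2 / μ * c.switch * V := by
    unfold switch
    split_ifs with h0
    · simp [h0]
    · have hb := hc.b_nonneg
      have hc1 := hc.c₁_nonneg
      calc _ ≤ c.b * c.c₁ * (4 * (1 + m.ν) ^ 2 * L ^ 2 / μ * (f x - f xstar)
            + 4 * m.ν ^ 2 * L ^ 2 / μ * (f xp - f xstar)) :=
            mul_le_mul_of_nonneg_left
              (hf.norm_gradient_extrapolation_sq_le hμ hxstar m.ν x xp) (by positivity)
        _ = 4 * c.b * (1 + m.ν) ^ 2 * L ^ 2 / μ * 1 * (c.c₁ * (f x - f xstar))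
            + 4 * c.b * m.ν ^ 2 * L ^ 2 / μ * 1 * (c.c₁ * (f xp - f xstar)) := by ring
        _ ≤ _ := by gcongr
  have h1 := mul_le_mul_of_nonneg_left hq (mul_nonneg hc.c₁_nonneg (sq_nonneg c.ρ₁))
  have h2 := mul_le_mul_of_nonneg_left hx (sq_nonneg c.ρ₂)
  have h3 := mul_le_mul_of_nonneg_left hV (sq_nonneg c.ρ₃)
  unfold p q
  linarith

/-- `V` dominates the suboptimality: minimizing the quadratic form of `P̃` over `xprev` leaves the
Schur complement `r̃`. -/
lemma Feasible.denom_mul_sub_le_lyapunov (hL : 0 < L) (hf : SmoothStronglyConvex μ L f)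
    (hxstar : ∀ x, f xstar ≤ f x) (hc : c.Feasible μ L m) (x xp : EuclideanSpace ℝ (Fin d)) :
    c.denom L * (f x - f xstar) ≤ c.lyapunov f xstar x xp := by
  have hs := hf.sub_le_sq hxstar x
  have hdet : 0 ≤ c.P 0 0 * c.P 1 1 - c.P 0 1 * c.P 0 1 := by
    have := hc.P_posSemidef.det_nonneg
    rwa [Matrix.det_fin_two, hc.P_symm] at this
  have h00 : 0 ≤ c.P 0 0 := hc.P_posSemidef.diag_nonneg
  have h11 : 0 ≤ c.P 1 1 := hc.P_posSemidef.diag_nonneg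
  have key : 0 ≤ c.rTilde ∧ c.rTilde * ‖x - xstar‖ ^ 2 ≤ c.quad (x - xstar) (xp - xstar) := by
    generalize x - xstar = u
    generalize xp - xstar = v
    unfold rTilde quad
    rw [hc.P_symm, real_inner_self_eq_norm_sq, real_inner_self_eq_norm_sq, real_inner_comm u v]
    split_ifs with h
    · have h11 := lt_of_le_of_ne h11 h.symm
      have hsq : 0 ≤ ‖(c.P 0 1 / c.P 1 1) • u + v‖ ^ 2 := sq_nonneg _
      rw [norm_add_sq_real, real_inner_smul_left, norm_smul, mul_pow, Real.norm_eq_abs,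
        sq_abs] at hsq
      refine ⟨?_, ?_⟩
      · rw [sub_nonneg, div_le_iff₀ h11]
        linarith
      · have := mul_nonneg h11.le hsq
        have e : c.P 1 1 * ((c.P 0 1 / c.P 1 1) ^ 2 * ‖u‖ ^ 2
            + 2 * (c.P 0 1 / c.P 1 1 * inner ℝ u v) + ‖v‖ ^ 2)
            = c.P 0 1 ^ 2 / c.P 1 1 * ‖u‖ ^ 2 + 2 * c.P 0 1 * inner ℝ u v
              + c.P 1 1 * ‖v‖ ^ 2 := by
          field_simp
        linarith
    · have h : c.P 1 1 = 0 := not_not.1 h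
      have h01 : c.P 0 1 = 0 := by
        rw [h] at hdet
        exact mul_self_eq_zero.1 (le_antisymm (by linarith) (mul_self_nonneg _))
      simp [h, h01, h00]
  have h2 : 2 / L * (f x - f xstar) ≤ ‖x - xstar‖ ^ 2 := by
    rw [div_mul_eq_mul_div, div_le_iff₀ hL]
    linarith
  have h3 := mul_le_mul_of_nonneg_left h2 key.1
  have h4 := key.2
  unfold denom lyapunov
  unfold quad at h4
  linarith

lemma Feasible.p_nonneg (hμ : 0 < μ) (hc : c.Feasible μ L m) : 0 ≤ c.p μ L m := by
  have := hc.b_nonneg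
  have := hc.c₁_nonneg
  unfold p switch
  split_ifs <;> positivity

lemma Feasible.q_nonneg (hμ : 0 < μ) (hc : c.Feasible μ L m) : 0 ≤ c.q μ L m := by
  have := hc.b_nonneg
  unfold q switch
  split_ifs <;> positivity

lemma Feasible.r_nonneg (hL : 0 < L) (hc : c.Feasible μ L m) : 0 ≤ c.r L m := by
  have := hc.a_nonneg
  have := hc.c₁_nonneg
  have : 0 ≤ c.P 0 0 := hc.P_posSemidef.diag_nonneg
  unfold r
  positivity

lemma Feasible.Hbar_sq (hL : 0 < L) (hc : c.Feasible μ L m) :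
    c.Hbar μ L m ^ 2 = c.r L m / (c.denom L * (1 - (c.p μ L m + c.q μ L m))) := by
  have h1 : 0 < 1 - (c.p μ L m + c.q μ L m) := sub_pos.2 hc.p_add_q_lt_one
  have := hc.r_nonneg hL
  have := hc.denom_pos
  rw [Hbar, Real.sq_sqrt (by positivity)]
  field_simp

/-- Summing `v_{k+1} ≤ p v_k + q v_{k-1} + e_{k+1}` over `k` bounds `∑ v_k` by `(1 - p - q)⁻¹` times
the initial value plus the accumulated errors. -/
lemma _root_.GMM.sum_le_of_two_step_recursion {p q : ℝ} (hp : 0 ≤ p) (hq : 0 ≤ q)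
    {v vp e : ℕ → ℝ} (hv : ∀ k, 0 ≤ v k) (h0 : vp 0 = v 0) (hvp : ∀ k, vp (k + 1) = v k)
    (h : ∀ k, v (k + 1) ≤ p * v k + q * vp k + e (k + 1)) (K : ℕ) :
    (1 - (p + q)) * ∑ k ∈ Finset.range (K + 1), v k
      ≤ (1 + q) * v 0 + ∑ k ∈ Finset.range K, e (k + 1) := by
  have key : ∑ k ∈ Finset.range (K + 1), v k + p * v K + q * v K + q * vp K
      ≤ (p + q) * ∑ k ∈ Finset.range (K + 1), v k + (1 + q) * v 0
        + ∑ k ∈ Finset.range K, e (k + 1) := by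
    induction K with
    | zero =>
      simp [h0]
      linarith
    | succ n ih =>
      rw [hvp, Finset.sum_range_succ v (n + 1), Finset.sum_range_succ (fun k => e (k + 1)) n]
      have := h n
      linarith
  have h1 : 0 ≤ vp K := by
    cases K with
    | zero => rw [h0]; exact hv 0
    | succ n => rw [hvp]; exact hv n
  have := mul_nonneg hp (hv K)
  have := mul_nonneg hq (hv K)
  have := mul_nonneg hq h1
  linarith

/-- The pathwise bound: the cumulative suboptimality is at most a constant plus `H̄_∞²` times the
energy of the gradient errors. -/
lemma Feasible.sum_sub_le (hμ : 0 < μ) (hμL : μ < L) (hf : SmoothStronglyConvex μ L f)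
    (hxstar : ∀ x, f xstar ≤ f x) (hc : c.Feasible μ L m) (x0 : EuclideanSpace ℝ (Fin d)) :
    ∃ C : ℝ, ∀ (w : ℕ → EuclideanSpace ℝ (Fin d)) (K : ℕ),
      ∑ k ∈ Finset.range (K + 1), (f (state f m x0 w k).1 - f xstar)
        ≤ C + c.Hbar μ L m ^ 2 * ∑ k ∈ Finset.range K, ‖w (k + 1)‖ ^ 2 := by
  have hL := hμ.trans hμL
  have hpq : 0 < 1 - (c.p μ L m + c.q μ L m) := sub_pos.2 hc.p_add_q_lt_one
  have hD := hc.denom_pos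
  refine ⟨(1 + c.q μ L m) * c.lyapunov f xstar x0 x0
    / (c.denom L * (1 - (c.p μ L m + c.q μ L m))), fun w K => ?_⟩
  let s := state f m x0 w
  let v : ℕ → ℝ := fun k => c.lyapunov f xstar (s k).1 (s k).2
  -- the sequence `V_{k-1}`, with the convention `V_{-1} = V_0`
  let vp : ℕ → ℝ := fun k => Nat.casesOn k (v 0) v
  have hvp : ∀ k, c.c₁ * (f (s k).2 - f xstar) ≤ vp k := by
    intro k
    cases k with
    | zero => exact hc.c₁_mul_sub_le_lyapunov x0 x0
    | succ n => exact hc.c₁_mul_sub_le_lyapunov (s n).1 (s n).2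
  have hsum := sum_le_of_two_step_recursion (v := v) (vp := vp)
    (e := fun k => c.r L m * ‖w k‖ ^ 2) (hc.p_nonneg hμ) (hc.q_nonneg hμ)
    (fun k => hc.lyapunov_nonneg hxstar _ _) rfl (fun _ => rfl)
    (fun k => hc.lyapunov_step hμ hμL hf hxstar (s k).1 (s k).2 (w (k + 1)) (hvp k)) K
  have hDs : c.denom L * ∑ k ∈ Finset.range (K + 1), (f (s k).1 - f xstar)
      ≤ ∑ k ∈ Finset.range (K + 1), v k := by
    rw [Finset.mul_sum]
    exact Finset.sum_le_sum fun k _ => hc.denom_mul_sub_le_lyapunov hL hf hxstar _ _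
  have := (mul_le_mul_of_nonneg_left hDs hpq.le).trans hsum
  rw [← Finset.mul_sum] at this
  rw [hc.Hbar_sq hL, div_mul_eq_mul_div, ← add_div, le_div_iff₀ (by positivity)]
  have e0 : v 0 = c.lyapunov f xstar x0 x0 := rfl
  rw [e0] at this
  linarith

end Certificate

/-! ### Exponential moments of the gradient errors -/

section LayerCake

variable {Ω : Type*} {mΩ : MeasurableSpace Ω}

/-- Layer cake formula under the tail bound `ν {t ≤ X} ≤ 2 e^{-t} ν Ω`. -/
lemma lintegral_intervalIntegral_le_of_tail {ν : Measure Ω} {X : Ω → ℝ} (hX : Measurable X)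
    (hX0 : ∀ ω, 0 ≤ X ω)
    (htail : ∀ t : ℝ, 0 < t → ν {ω | t ≤ X ω} ≤ ENNReal.ofReal (2 * Real.exp (-t)) * ν Set.univ)
    {g : ℝ → ℝ} (hg : Continuous g) (hg0 : ∀ t, 0 ≤ g t) :
    ∫⁻ ω, ENNReal.ofReal (∫ t in (0 : ℝ)..X ω, g t) ∂ν
      ≤ (∫⁻ t in Set.Ioi 0, ENNReal.ofReal (2 * Real.exp (-t) * g t)) * ν Set.univ := by
  rw [lintegral_comp_eq_lintegral_meas_le_mul ν (ae_of_all _ hX0) hX.aemeasurable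
    (fun t _ => hg.intervalIntegrable 0 t) (ae_of_all _ hg0),
    ← lintegral_mul_const _ (by fun_prop)]
  refine setLIntegral_mono' measurableSet_Ioi fun t ht => ?_
  rw [ENNReal.ofReal_mul (by positivity), mul_right_comm]
  exact mul_le_mul_left (htail t ht) _

lemma lintegral_Ioi_two_mul_exp {s : ℝ} (hs : s < 1) :
    ∫⁻ t in Set.Ioi 0, ENNReal.ofReal (2 * Real.exp (-t) * Real.exp (s * t))
      = ENNReal.ofReal (2 / (1 - s)) := by
  have h1 : s - 1 < 0 := by linarith
  have e : ∀ t : ℝ, 2 * Real.exp (-t) * Real.exp (s * t) = 2 * Real.exp ((s - 1) * t) := by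
    intro t
    rw [mul_assoc, ← Real.exp_add]
    ring_nf
  simp_rw [e]
  rw [← ofReal_integral_eq_lintegral_ofReal ((integrableOn_exp_mul_Ioi h1 0).const_mul 2)
    (ae_of_all _ fun t => by positivity), integral_const_mul, integral_exp_mul_Ioi h1]
  congr 1
  have : 1 - s ≠ 0 := by linarith
  have : s - 1 ≠ 0 := h1.ne
  simp
  field_simp
  ring

/-- `X` has exponential moments `E e^{sX} ≤ 1 + ∫₀^∞ s e^{st} 2 e^{-t} dt = (1 + s) / (1 - s)`. -/
lemma lintegral_exp_mul_le_of_tail {ν : Measure Ω} {X : Ω → ℝ} (hX : Measurable X)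
    (hX0 : ∀ ω, 0 ≤ X ω)
    (htail : ∀ t : ℝ, 0 < t → ν {ω | t ≤ X ω} ≤ ENNReal.ofReal (2 * Real.exp (-t)) * ν Set.univ)
    {s : ℝ} (hs0 : 0 ≤ s) (hs : s < 1) :
    ∫⁻ ω, ENNReal.ofReal (Real.exp (s * X ω)) ∂ν
      ≤ ENNReal.ofReal ((1 + s) / (1 - s)) * ν Set.univ := by
  have hexp : ∀ x : ℝ, ∫ t in (0 : ℝ)..x, s * Real.exp (s * t) = Real.exp (s * x) - 1 := by
    intro x
    rw [intervalIntegral.integral_eq_sub_of_hasDerivAt (f := fun t => Real.exp (s * t))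
      (fun t _ => ?_) ((by fun_prop : Continuous fun t => s * Real.exp (s * t)).intervalIntegrable
        0 x)]
    · simp
    · simpa [mul_comm] using ((hasDerivAt_id t).const_mul s).exp
  have h1 : ∀ ω, ENNReal.ofReal (Real.exp (s * X ω))
      = 1 + ENNReal.ofReal (∫ t in (0 : ℝ)..X ω, s * Real.exp (s * t)) := by
    intro ω
    have : 0 ≤ Real.exp (s * X ω) - 1 := by
      linarith [Real.one_le_exp (mul_nonneg hs0 (hX0 ω))]
    rw [hexp, ← ENNReal.ofReal_one, ← ENNReal.ofReal_add zero_le_one this, add_sub_cancel]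
  have h2 := lintegral_intervalIntegral_le_of_tail hX hX0 htail
    (by fun_prop : Continuous fun t => s * Real.exp (s * t)) (fun t => by positivity)
  have h3 : ∫⁻ t in Set.Ioi 0, ENNReal.ofReal (2 * Real.exp (-t) * (s * Real.exp (s * t)))
      = ENNReal.ofReal (2 * s / (1 - s)) := by
    have e : ∀ t : ℝ, 2 * Real.exp (-t) * (s * Real.exp (s * t))
        = s * (2 * Real.exp (-t) * Real.exp (s * t)) := fun t => by ring
    simp_rw [e, ENNReal.ofReal_mul hs0]
    rw [lintegral_const_mul _ (by fun_prop), lintegral_Ioi_two_mul_exp hs,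
      ← ENNReal.ofReal_mul hs0]
    ring_nf
  have h4 : 0 < 1 - s := sub_pos.2 hs
  have e : (1 + s) / (1 - s) = 1 + 2 * s / (1 - s) := by field_simp; ring
  simp_rw [h1]
  rw [lintegral_add_left measurable_const, lintegral_const, one_mul, e,
    ENNReal.ofReal_add zero_le_one (by positivity), ENNReal.ofReal_one, add_mul, one_mul, ← h3]
  gcongr

lemma lintegral_le_two_of_tail {ν : Measure Ω} {X : Ω → ℝ} (hX : Measurable X)
    (hX0 : ∀ ω, 0 ≤ X ω)
    (htail : ∀ t : ℝ, 0 < t → ν {ω | t ≤ X ω} ≤ ENNReal.ofReal (2 * Real.exp (-t)) * ν Set.univ) :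
    ∫⁻ ω, ENNReal.ofReal (X ω) ∂ν ≤ 2 * ν Set.univ := by
  have h := lintegral_intervalIntegral_le_of_tail hX hX0 htail (g := fun _ => 1)
    continuous_const (fun _ => zero_le_one)
  have h1 := lintegral_Ioi_two_mul_exp zero_lt_one
  simp only [zero_mul, Real.exp_zero, sub_zero, div_one] at h1
  rw [h1] at h
  simpa using h

/-- A conditional probability bounded by a constant `b` tests against every nonnegative random
variable measurable for the conditioning `σ`-algebra. -/
lemma setLIntegral_le_of_condProb_le {Pr : Measure Ω} [IsProbabilityMeasure Pr]
    {F : MeasurableSpace Ω} (hF : F ≤ mΩ) {A : Set Ω} (hA : MeasurableSet[mΩ] A)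
    {b : ℝ} (hb : 0 ≤ b) (h : ∀ᵐ ω ∂Pr, (Pr⟦A | F⟧) ω ≤ b)
    {Y : Ω → ENNReal} (hY : Measurable[F] Y) :
    ∫⁻ ω in A, Y ω ∂Pr ≤ ENNReal.ofReal b * ∫⁻ ω, Y ω ∂Pr := by
  rw [← lintegral_trim hF hY, ← lintegral_trim hF hY, ← smul_eq_mul, ← lintegral_smul_measure]
  refine lintegral_mono' (Measure.le_iff.2 fun B hB => ?_) le_rfl
  rw [Measure.smul_apply, trim_measurableSet_eq hF hB, trim_measurableSet_eq hF hB,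
    Measure.restrict_apply (hF B hB), smul_eq_mul]
  have hint : Integrable (A.indicator fun _ => (1 : ℝ)) Pr :=
    (integrable_const 1).indicator hA
  have h1 := setIntegral_condExp hF hint hB
  have h2 : ∫ ω in B, (Pr⟦A | F⟧) ω ∂Pr ≤ ∫ _ in B, b ∂Pr :=
    setIntegral_mono_ae integrable_condExp.integrableOn (integrable_const b).integrableOn h
  rw [h1, integral_indicator_const _ hA, setIntegral_const, measureReal_restrict_apply hA,
    Set.inter_comm, smul_eq_mul, smul_eq_mul, mul_one, mul_comm] at h2
  rw [← ENNReal.ofReal_toReal (measure_ne_top Pr (B ∩ A)),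
    ← ENNReal.ofReal_toReal (measure_ne_top Pr B), ← ENNReal.ofReal_mul hb]
  exact ENNReal.ofReal_le_ofReal h2

end LayerCake

section Noise

variable {d : ℕ} {Ω : Type*} {mΩ : MeasurableSpace Ω} {Pr : Measure Ω} {μ L : ℝ}
  {f : EuclideanSpace ℝ (Fin d) → ℝ} {m : Params} {x0 : EuclideanSpace ℝ (Fin d)}
  {w : ℕ → Ω → EuclideanSpace ℝ (Fin d)} {σ : ℝ}

lemma SmoothStronglyConvex.continuous_gradient (hf : SmoothStronglyConvex μ L f) :
    Continuous (gradient f) := by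
  refine (LipschitzWith.of_dist_le_mul (K := L.toNNReal) fun x y => ?_).continuous
  rw [dist_eq_norm, dist_eq_norm]
  refine (hf.lipschitz_gradient x y).trans ?_
  gcongr
  exact Real.le_coe_toNNReal L

lemma measurable_state (hf : SmoothStronglyConvex μ L f) (hw : ∀ k, Measurable (w (k + 1)))
    (k : ℕ) : Measurable fun ω => state f m x0 (fun j => w j ω) k := by
  induction k with
  | zero => exact measurable_const
  | succ n ih =>
    have hg := hf.continuous_gradient.measurable
    have h1 := ih.fst
    have h2 := ih.snd
    have h3 := hw n
    have h4 := hg.comp (h1.add ((h1.sub h2).const_smul m.ν))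
    exact ((h1.sub ((h4.add h3).const_smul m.α)).add ((h1.sub h2).const_smul m.β)).prodMk h1

lemma measurable_iterate (hf : SmoothStronglyConvex μ L f) (hw : ∀ k, Measurable (w (k + 1)))
    (k : ℕ) : Measurable (iterate f m x0 w k) :=
  (measurable_state hf hw k).fst

lemma history_le (hf : SmoothStronglyConvex μ L f) (hw : ∀ k, Measurable (w (k + 1))) (k : ℕ) :
    history f m x0 w k ≤ mΩ :=
  iSup₂_le fun j _ => (measurable_iterate hf hw j).comap_le

lemma history_mono {j k : ℕ} (h : j ≤ k) : history f m x0 w j ≤ history f m x0 w k :=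
  biSup_mono fun i hi => by simp only [Finset.mem_range] at hi ⊢; omega

/-- The tail bound for `‖w_{k+1}‖² / (2σ²)` under the measure with an `F_k`-measurable density. -/
lemma SubGaussianNoise.withDensity_tail_le [IsProbabilityMeasure Pr]
    (hf : SmoothStronglyConvex μ L f) (hσ : 0 < σ) (hw : SubGaussianNoise Pr f m x0 w σ) (k : ℕ)
    {Y : Ω → ENNReal} (hY : Measurable[history f m x0 w k] Y) {t : ℝ} (ht : 0 < t) :
    Pr.withDensity Y {ω | t ≤ ‖w (k + 1) ω‖ ^ 2 / (2 * σ ^ 2)}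
      ≤ ENNReal.ofReal (2 * Real.exp (-t)) * Pr.withDensity Y Set.univ := by
  have hset : {ω | t ≤ ‖w (k + 1) ω‖ ^ 2 / (2 * σ ^ 2)}
      = {ω | Real.sqrt (2 * σ ^ 2 * t) ≤ ‖w (k + 1) ω‖} := by
    ext ω
    rw [Set.mem_ofPred_eq, Set.mem_ofPred_eq, le_div_iff₀ (by positivity),
      Real.sqrt_le_left (norm_nonneg _), mul_comm]
  have hA : MeasurableSet {ω | Real.sqrt (2 * σ ^ 2 * t) ≤ ‖w (k + 1) ω‖} :=
    measurableSet_le measurable_const (hw.measurable k).norm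
  have htail := hw.tail k _ (Real.sqrt_nonneg (2 * σ ^ 2 * t))
  rw [Real.sq_sqrt (by positivity), neg_div, mul_div_cancel_left₀ _ (by positivity)] at htail
  rw [hset, withDensity_apply _ hA, withDensity_apply _ MeasurableSet.univ, setLIntegral_univ]
  exact setLIntegral_le_of_condProb_le (history_le hf hw.measurable k) hA (by positivity) htail hY

/-- Stated for an arbitrary `σ`-algebra on `Ω`, so that it applies to the histories `F_n`. -/
lemma measurable_exp_sum {s : ℝ} (n : ℕ) (hw : ∀ k < n, Measurable (w (k + 1))) :
    Measurable fun ω => ENNReal.ofReal (Real.exp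
      (s * ∑ k ∈ Finset.range n, ‖w (k + 1) ω‖ ^ 2 / (2 * σ ^ 2))) := by
  refine ENNReal.measurable_ofReal.comp (Real.measurable_exp.comp
    (Measurable.const_mul (Finset.measurable_sum _ fun k hk => ?_) s))
  exact ((hw k (Finset.mem_range.1 hk)).norm.pow_const 2).div_const _

/-- Conditioning successively on `F_{K-1}, …, F_0` bounds the exponential moment of the energy of
the gradient errors by a power. -/
lemma SubGaussianNoise.lintegral_exp_sum_le [IsProbabilityMeasure Pr]
    (hf : SmoothStronglyConvex μ L f) (hσ : 0 < σ) (hw : SubGaussianNoise Pr f m x0 w σ)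
    {s : ℝ} (hs0 : 0 ≤ s) (hs : s < 1) (K : ℕ) :
    ∫⁻ ω, ENNReal.ofReal (Real.exp
        (s * ∑ k ∈ Finset.range K, ‖w (k + 1) ω‖ ^ 2 / (2 * σ ^ 2))) ∂Pr
      ≤ ENNReal.ofReal ((1 + s) / (1 - s)) ^ K := by
  induction K with
  | zero => simp
  | succ n ih =>
    set Y : Ω → ENNReal := fun ω => ENNReal.ofReal (Real.exp
        (s * ∑ k ∈ Finset.range n, ‖w (k + 1) ω‖ ^ 2 / (2 * σ ^ 2))) with hYdef
    have hY : Measurable[history f m x0 w n] Y := by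
      refine measurable_exp_sum (mΩ := history f m x0 w n) n fun k hk => ?_
      exact (hw.adapted k).mono (history_mono hk) le_rfl
    have hX : Measurable fun ω => ‖w (n + 1) ω‖ ^ 2 / (2 * σ ^ 2) :=
      ((hw.measurable n).norm.pow_const 2).div_const _
    have h := lintegral_exp_mul_le_of_tail (ν := Pr.withDensity Y) hX (fun ω => by positivity)
      (fun t ht => hw.withDensity_tail_le hf hσ n hY ht) hs0 hs
    rw [lintegral_withDensity_eq_lintegral_mul _
      (hY.mono (history_le hf hw.measurable n) le_rfl) (by fun_prop),
      withDensity_apply _ MeasurableSet.univ, setLIntegral_univ] at h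
    have e : ∀ ω, ENNReal.ofReal (Real.exp
        (s * ∑ k ∈ Finset.range (n + 1), ‖w (k + 1) ω‖ ^ 2 / (2 * σ ^ 2)))
        = (Y * fun ω => ENNReal.ofReal (Real.exp (s * (‖w (n + 1) ω‖ ^ 2 / (2 * σ ^ 2))))) ω := by
      intro ω
      rw [Pi.mul_apply, hYdef, ← ENNReal.ofReal_mul (Real.exp_nonneg _), ← Real.exp_add,
        Finset.sum_range_succ, mul_add]
    simp_rw [e]
    rw [pow_succ' (ENNReal.ofReal _)]
    exact h.trans (mul_le_mul_right ih _)

lemma SubGaussianNoise.lintegral_sq_le [IsProbabilityMeasure Pr]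
    (hf : SmoothStronglyConvex μ L f) (hσ : 0 < σ) (hw : SubGaussianNoise Pr f m x0 w σ) (k : ℕ) :
    ∫⁻ ω, ENNReal.ofReal (‖w (k + 1) ω‖ ^ 2 / (2 * σ ^ 2)) ∂Pr ≤ 2 := by
  have hX : Measurable fun ω => ‖w (k + 1) ω‖ ^ 2 / (2 * σ ^ 2) :=
    ((hw.measurable k).norm.pow_const 2).div_const _
  have := lintegral_le_two_of_tail (ν := Pr.withDensity 1) hX (fun ω => by positivity)
    (fun t ht => hw.withDensity_tail_le hf hσ k measurable_const ht)
  simpa using this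

lemma SubGaussianNoise.integrable_sq [IsProbabilityMeasure Pr]
    (hf : SmoothStronglyConvex μ L f) (hσ : 0 < σ) (hw : SubGaussianNoise Pr f m x0 w σ) (k : ℕ) :
    Integrable (fun ω => ‖w (k + 1) ω‖ ^ 2) Pr := by
  have hX : Measurable fun ω => ‖w (k + 1) ω‖ ^ 2 / (2 * σ ^ 2) :=
    ((hw.measurable k).norm.pow_const 2).div_const _
  have h : Integrable (fun ω => ‖w (k + 1) ω‖ ^ 2 / (2 * σ ^ 2)) Pr :=
    (lintegral_ofReal_ne_top_iff_integrable hX.aestronglyMeasurable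
      (ae_of_all _ fun ω => by positivity)).1
      ((hw.lintegral_sq_le hf hσ k).trans_lt (by simp)).ne
  refine (h.const_mul (2 * σ ^ 2)).congr (ae_of_all _ fun ω => ?_)
  exact mul_div_cancel₀ _ (by positivity)

lemma SubGaussianNoise.integral_sq_le [IsProbabilityMeasure Pr]
    (hf : SmoothStronglyConvex μ L f) (hσ : 0 < σ) (hw : SubGaussianNoise Pr f m x0 w σ) (k : ℕ) :
    ∫ ω, ‖w (k + 1) ω‖ ^ 2 ∂Pr ≤ 4 * σ ^ 2 := by
  have h1 := hw.lintegral_sq_le hf hσ k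
  rw [← ofReal_integral_eq_lintegral_ofReal ((hw.integrable_sq hf hσ k).div_const _)
    (ae_of_all _ fun ω => by positivity), integral_div] at h1
  have h2 := ENNReal.toReal_le_of_le_ofReal zero_le_two (h1.trans (by simp))
  rw [ENNReal.toReal_ofReal (by positivity), div_le_iff₀ (by positivity)] at h2
  linarith

end Noise

/-! ### Asymptotics of the bound -/

/-- The limiting bound `(2σ²/θ) log((1 + θ h) / (1 - θ h))`, where `h` stands for `H̄_∞²`. -/
noncomputable def limitBound (σ h θ : ℝ) : ℝ :=
  2 * σ ^ 2 / θ * Real.log ((1 + θ * h) / (1 - θ * h))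

lemma tendsto_limitBound (σ h : ℝ) :
    Tendsto (limitBound σ h) (𝓝[>] 0) (𝓝 (4 * σ ^ 2 * h)) := by
  have h1 : HasDerivAt (fun θ : ℝ => Real.log (1 + θ * h) - Real.log (1 - θ * h)) (2 * h) 0 := by
    have ha : HasDerivAt (fun θ : ℝ => 1 + θ * h) h 0 := by
      simpa using ((hasDerivAt_id (0 : ℝ)).mul_const h).const_add 1
    have hb : HasDerivAt (fun θ : ℝ => 1 - θ * h) (-h) 0 := by
      simpa using ((hasDerivAt_id (0 : ℝ)).mul_const h).const_sub 1
    refine ((ha.log (by simp)).sub (hb.log (by simp))).congr_deriv ?_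
    simp
    ring
  have h2 := (h1.tendsto_slope_zero_right).const_mul (2 * σ ^ 2)
  have e : 2 * σ ^ 2 * (2 * h) = 4 * σ ^ 2 * h := by ring
  rw [e] at h2
  refine h2.congr' ?_
  have hp : ∀ᶠ θ : ℝ in 𝓝[>] 0, 0 < 1 + θ * h := by
    refine nhdsWithin_le_nhds (ContinuousAt.eventually_lt (by fun_prop) (by fun_prop) (by simp))
  have hm : ∀ᶠ θ : ℝ in 𝓝[>] 0, 0 < 1 - θ * h := by
    refine nhdsWithin_le_nhds (ContinuousAt.eventually_lt (by fun_prop) (by fun_prop) (by simp))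
  filter_upwards [hp, hm] with θ hpθ hmθ
  rw [limitBound, Real.log_div hpθ.ne' hmθ.ne']
  simp
  ring

/-- The limiting bound at `θ / J`, multiplied by `1 / J`, is no smaller than at `θ` when `J ≤ 1`. -/
lemma limitBound_le_div {σ h θ J : ℝ} (hh : 0 ≤ h) (hθ : 0 < θ) (hJ0 : 0 < J) (hJ : J ≤ 1)
    (h1 : θ / J * h < 1) : limitBound σ h θ ≤ 1 / J * limitBound σ h (θ / J) := by
  have hle : θ * h ≤ θ / J * h := by
    gcongr
    exact le_div_self hθ.le hJ0 hJ
  have h0 : 0 ≤ θ * h := by positivity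
  have e : 1 / J * (2 * σ ^ 2 / (θ / J)) = 2 * σ ^ 2 / θ := by field_simp
  rw [limitBound, limitBound, ← mul_assoc, e]
  have : 0 < 1 - θ / J * h := by linarith
  have : 0 < 1 - θ * h := by linarith
  gcongr

/-- Cesàro averages of a convergent sequence, indexed backwards from `K`. -/
lemma tendsto_sum_Icc_div {G : ℕ → ℝ} {l : ℝ} (hG : Tendsto G atTop (𝓝 l)) :
    Tendsto (fun K : ℕ => (∑ j ∈ Finset.Icc 1 K, G (K - j + 1)) / K) atTop (𝓝 l) := by
  have h := ((tendsto_add_atTop_iff_nat 1).2 hG).cesaro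
  refine h.congr fun K => ?_
  rw [inv_mul_eq_div]
  congr 1
  refine Finset.sum_nbij' (fun i => K - i) (fun j => K - j) ?_ ?_ ?_ ?_ ?_ <;> intro i hi <;>
    simp only [Finset.mem_range, Finset.mem_Icc] at hi ⊢
  · omega
  · omega
  · omega
  · omega
  · congr 1
    omega

lemma tendsto_div_add_one {u : ℕ → ℝ} {l : ℝ} (hu : Tendsto (fun K : ℕ => u K / K) atTop (𝓝 l)) :
    Tendsto (fun K : ℕ => u K / ((K : ℝ) + 1)) atTop (𝓝 l) := by
  have h := hu.mul (tendsto_natCast_div_add_atTop (1 : ℝ))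
  rw [mul_one] at h
  refine h.congr' ?_
  filter_upwards [eventually_ne_atTop 0] with K hK
  have : (K : ℝ) ≠ 0 := Nat.cast_ne_zero.2 hK
  field_simp

lemma tendsto_affine_div_add_one (a b : ℝ) :
    Tendsto (fun K : ℕ => (a + K * b) / ((K : ℝ) + 1)) atTop (𝓝 b) := by
  refine tendsto_div_add_one ?_
  have h := (tendsto_const_div_atTop_nhds_zero_nat a).add_const b
  rw [zero_add] at h
  refine h.congr' ?_
  filter_upwards [eventually_ne_atTop 0] with K hK
  have : (K : ℝ) ≠ 0 := Nat.cast_ne_zero.2 hK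
  field_simp

namespace Certificate

variable {d : ℕ} {μ L : ℝ} {m : Params} {c : Certificate}

lemma Hbar_nonneg : 0 ≤ c.Hbar μ L m := Real.sqrt_nonneg _

lemma sqrt_mul_Hbar_lt_one_iff {θ : ℝ} (hθ : 0 ≤ θ) :
    Real.sqrt θ * c.Hbar μ L m < 1 ↔ θ * c.Hbar μ L m ^ 2 < 1 := by
  rw [← sq_lt_one_iff₀ (mul_nonneg (Real.sqrt_nonneg θ) Hbar_nonneg), mul_pow, Real.sq_sqrt hθ]

lemma Feasible.p_le_lamPlus (hμ : 0 < μ) (hc : c.Feasible μ L m) :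
    c.p μ L m ≤ c.lamPlus μ L m := by
  have : c.p μ L m ≤ Real.sqrt (c.p μ L m ^ 2 + 4 * c.q μ L m) :=
    Real.le_sqrt_of_sq_le (by linarith [hc.q_nonneg hμ])
  unfold lamPlus
  linarith

lemma Feasible.lamPlus_lt_one (hμ : 0 < μ) (hc : c.Feasible μ L m) : c.lamPlus μ L m < 1 := by
  have hp := hc.p_nonneg hμ
  have hq := hc.q_nonneg hμ
  have hpq := hc.p_add_q_lt_one
  have : Real.sqrt (c.p μ L m ^ 2 + 4 * c.q μ L m) < 2 - c.p μ L m := by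
    rw [Real.sqrt_lt' (by linarith)]
    linarith
  unfold lamPlus
  linarith

lemma Feasible.J_pos (hμ : 0 < μ) (hc : c.Feasible μ L m) : 0 < c.J μ L m := by
  have := hc.p_le_lamPlus hμ
  exact one_div_pos.2 (by linarith)

lemma Feasible.J_le_one (hμ : 0 < μ) (hc : c.Feasible μ L m) : c.J μ L m ≤ 1 := by
  have := hc.p_le_lamPlus hμ
  exact (div_le_one (by linarith)).2 (by linarith)

/-- `c̄(K, θ)` is finite when `θ H̄_∞² < 1` and grows like `K D` times the limiting bound, because
`a_{j,K}` tends to `1 / (1 - (p + q))` as `K - j` grows. -/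
lemma Feasible.exists_cBar_eq (hμ : 0 < μ) (hL : 0 < L) (hc : c.Feasible μ L m) (σ V0 : ℝ)
    {θ : ℝ} (hθ : 0 < θ) (h1 : θ * c.Hbar μ L m ^ 2 < 1) :
    ∃ u : ℕ → ℝ, (∀ K, c.cBar μ L m σ V0 K θ = (u K : EReal)) ∧
      Tendsto (fun K : ℕ => u K / K) atTop
        (𝓝 (c.denom L * limitBound σ (c.Hbar μ L m ^ 2) θ)) := by
  have hD := hc.denom_pos
  have hpq : 0 < 1 - (c.p μ L m + c.q μ L m) := sub_pos.2 hc.p_add_q_lt_one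
  have hlam0 : 0 ≤ c.lamPlus μ L m := (hc.p_nonneg hμ).trans (hc.p_le_lamPlus hμ)
  have hlam1 := hc.lamPlus_lt_one hμ
  have hlim := tendsto_pow_atTop_nhds_zero_of_lt_one hlam0 hlam1
  let ψ : ℝ → ℝ := fun z => Real.log ((c.denom L + c.r L m * θ * ((1 - z)
    / (1 - (c.p μ L m + c.q μ L m)))) / (c.denom L - c.r L m * θ * ((1 - z)
    / (1 - (c.p μ L m + c.q μ L m)))))
  have e1 : c.r L m * θ * ((1 - 0) / (1 - (c.p μ L m + c.q μ L m)))
      = c.denom L * (θ * c.Hbar μ L m ^ 2) := by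
    rw [hc.Hbar_sq hL]
    field_simp
    ring
  have hψ0 : ψ 0 = Real.log ((1 + θ * c.Hbar μ L m ^ 2) / (1 - θ * c.Hbar μ L m ^ 2)) := by
    simp only [ψ]
    rw [e1, ← mul_one_add, ← mul_one_sub, mul_div_mul_left _ _ hD.ne']
  have hnum : c.denom L + c.r L m * θ * ((1 - 0) / (1 - (c.p μ L m + c.q μ L m))) ≠ 0 := by
    rw [e1]
    positivity
  have hden : c.denom L - c.r L m * θ * ((1 - 0) / (1 - (c.p μ L m + c.q μ L m))) ≠ 0 := by
    rw [e1, ← mul_one_sub]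
    exact (mul_pos hD (sub_pos.2 h1)).ne'
  have hψ : ContinuousAt ψ 0 := by
    refine ContinuousAt.log (ContinuousAt.div (by fun_prop) (by fun_prop) hden)
      (div_ne_zero hnum hden)
  have hG : Tendsto (fun n : ℕ => ψ (c.lamPlus μ L m ^ n)) atTop (𝓝 (ψ 0)) := hψ.tendsto.comp hlim
  refine ⟨fun K => ((1 - c.lamPlus μ L m ^ (K + 1)) / (1 - c.lamPlus μ L m) - 1 + c.J μ L m) * V0
    + 2 * σ ^ 2 * c.denom L / θ * ∑ j ∈ Finset.Icc 1 K, ψ (c.lamPlus μ L m ^ (K - j + 1)),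
    fun K => ?_, ?_⟩
  · rw [cBar, cHat, if_pos ((sqrt_mul_Hbar_lt_one_iff hθ.le).2 h1), ← EReal.coe_add]
    rfl
  · have ha : Tendsto (fun K : ℕ => ((1 - c.lamPlus μ L m ^ (K + 1)) / (1 - c.lamPlus μ L m) - 1
        + c.J μ L m) * V0 / (K : ℝ)) atTop (𝓝 0) := by
      refine Tendsto.div_atTop (a := ((1 - 0) / (1 - c.lamPlus μ L m) - 1 + c.J μ L m) * V0) ?_
        tendsto_natCast_atTop_atTop
      exact ((((((tendsto_add_atTop_iff_nat 1).2 hlim).const_sub 1).div_const _).sub_const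
        1).add_const _).mul_const _
    have hb := (tendsto_sum_Icc_div hG).const_mul (2 * σ ^ 2 * c.denom L / θ)
    have h := ha.add hb
    have e2 : 0 + 2 * σ ^ 2 * c.denom L / θ * ψ 0
        = c.denom L * limitBound σ (c.Hbar μ L m ^ 2) θ := by
      rw [hψ0, limitBound]
      ring
    rw [e2] at h
    refine h.congr fun K => ?_
    ring

/-- Of the two bounds in the minimum, `c̄(K + 1, θ)` is asymptotically the smaller one. -/
lemma Feasible.tendsto_riskCostBound (hμ : 0 < μ) (hL : 0 < L) (hc : c.Feasible μ L m)
    (σ V0 : ℝ) {θ : ℝ} (hθ : 0 < θ) (h1 : θ * c.Hbar μ L m ^ 2 < 1) :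
    Tendsto (fun K => c.riskCostBound μ L m σ V0 θ K) atTop
      (𝓝 ((limitBound σ (c.Hbar μ L m ^ 2) θ : ℝ) : EReal)) := by
  have hD := hc.denom_pos
  have hJ0 := hc.J_pos hμ
  have hJ1 := hc.J_le_one hμ
  obtain ⟨u, hu, hlim⟩ := hc.exists_cBar_eq hμ hL σ V0 hθ h1
  have hsecond : Tendsto (fun K : ℕ => 1 / (c.denom L * ((K : ℝ) + 1)) * u (K + 1)) atTop
      (𝓝 (limitBound σ (c.Hbar μ L m ^ 2) θ)) := by
    have h := ((tendsto_add_atTop_iff_nat 1).2 hlim).const_mul (1 / c.denom L)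
    have e : 1 / c.denom L * (c.denom L * limitBound σ (c.Hbar μ L m ^ 2) θ)
        = limitBound σ (c.Hbar μ L m ^ 2) θ := by field_simp
    rw [e] at h
    refine h.congr fun K => ?_
    push_cast
    field_simp
  have hsqrt : Real.sqrt θ * c.Hbar μ L m < 1 := (sqrt_mul_Hbar_lt_one_iff hθ.le).2 h1
  have hpos : ∀ K : ℕ, 0 ≤ 1 / (c.denom L * ((K : ℝ) + 1)) := fun K => by positivity
  by_cases h2 : θ / c.J μ L m * c.Hbar μ L m ^ 2 < 1
  · obtain ⟨u', hu', hlim'⟩ := hc.exists_cBar_eq hμ hL σ V0 (div_pos hθ hJ0) h2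
    have hfirst : Tendsto (fun K : ℕ => 1 / (c.denom L * ((K : ℝ) + 1)) *
        (1 / c.J μ L m * u' K)) atTop
        (𝓝 (1 / c.J μ L m * limitBound σ (c.Hbar μ L m ^ 2) (θ / c.J μ L m))) := by
      have h := (tendsto_div_add_one hlim').const_mul (1 / c.denom L * (1 / c.J μ L m))
      have e : 1 / c.denom L * (1 / c.J μ L m) *
          (c.denom L * limitBound σ (c.Hbar μ L m ^ 2) (θ / c.J μ L m))
          = 1 / c.J μ L m * limitBound σ (c.Hbar μ L m ^ 2) (θ / c.J μ L m) := by field_simp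
      rw [e] at h
      refine h.congr fun K => ?_
      field_simp
    have hmin := hfirst.min hsecond
    rw [min_eq_right (limitBound_le_div (sq_nonneg _) hθ hJ0 hJ1 h2)] at hmin
    refine ((continuous_coe_real_ereal.tendsto _).comp hmin).congr fun K => ?_
    rw [riskCostBound, if_pos hsqrt, hu, hu', ← EReal.coe_mul, Function.comp_apply,
      ← mul_min_of_nonneg _ _ (hpos K), EReal.coe_mul]
    congr 1
  · refine ((continuous_coe_real_ereal.tendsto _).comp hsecond).congr fun K => ?_
    have htop : ((1 / c.J μ L m : ℝ) : EReal) * c.cBar μ L m σ V0 K (θ / c.J μ L m) = ⊤ := by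
      rw [cBar, cHat, if_neg ((sqrt_mul_Hbar_lt_one_iff (div_pos hθ hJ0).le).not.2 h2),
        EReal.coe_add_top, EReal.coe_mul_top_of_pos (one_div_pos.2 hJ0)]
    rw [riskCostBound, if_pos hsqrt, htop, hu, min_eq_right le_top, Function.comp_apply,
      EReal.coe_mul]

lemma Feasible.riskIndexBound_eq (hμ : 0 < μ) (hL : 0 < L) (hc : c.Feasible μ L m)
    (σ V0 : ℝ) {θ : ℝ} (hθ : 0 < θ) :
    c.riskIndexBound μ L m σ V0 θ =
      if Real.sqrt θ * c.Hbar μ L m < 1 then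
        ((limitBound σ (c.Hbar μ L m ^ 2) θ : ℝ) : EReal) else ⊤ := by
  split_ifs with h
  · exact (hc.tendsto_riskCostBound hμ hL σ V0 hθ
      ((sqrt_mul_Hbar_lt_one_iff hθ.le).1 h)).limsup_eq
  · unfold riskIndexBound riskCostBound
    simp only [if_neg h]
    exact limsup_const ⊤

lemma Feasible.tendsto_riskIndexBound (hμ : 0 < μ) (hL : 0 < L) (hc : c.Feasible μ L m)
    (σ V0 : ℝ) :
    Tendsto (fun θ : ℝ => c.riskIndexBound μ L m σ V0 θ) (𝓝[>] 0)
      (𝓝 ((4 * σ ^ 2 * c.Hbar μ L m ^ 2 : ℝ) : EReal)) := by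
  refine ((continuous_coe_real_ereal.tendsto _).comp
    (tendsto_limitBound σ (c.Hbar μ L m ^ 2))).congr' ?_
  have h : ∀ᶠ θ : ℝ in 𝓝[>] 0, Real.sqrt θ * c.Hbar μ L m < 1 := by
    refine nhdsWithin_le_nhds (ContinuousAt.eventually_lt (by fun_prop) (by fun_prop) (by simp))
  filter_upwards [h, self_mem_nhdsWithin] with θ hθ1 hθ
  rw [hc.riskIndexBound_eq hμ hL σ V0 hθ, if_pos hθ1, Function.comp_apply]

end Certificate

/-! ### The risk-sensitive index and the averaged iterate -/

section Noise

variable {d : ℕ} {Ω : Type*} {mΩ : MeasurableSpace Ω} {Pr : Measure Ω} {μ L : ℝ}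
  {f : EuclideanSpace ℝ (Fin d) → ℝ} {m : Params} {x0 xstar : EuclideanSpace ℝ (Fin d)}
  {w : ℕ → Ω → EuclideanSpace ℝ (Fin d)} {σ : ℝ}

/-- A pathwise bound of `S_K` by the energy of the errors with gain `h` bounds the risk-sensitive
index for `θ h < 1`. -/
lemma SubGaussianNoise.riskIndex_le [IsProbabilityMeasure Pr]
    (hf : SmoothStronglyConvex μ L f) (hσ : 0 < σ) (hw : SubGaussianNoise Pr f m x0 w σ)
    {C h : ℝ} (hh : 0 ≤ h)
    (hS : ∀ K ω, cumulativeSubopt f (f xstar) m x0 w K ω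
      ≤ C + h * ∑ k ∈ Finset.range K, ‖w (k + 1) ω‖ ^ 2)
    {θ : ℝ} (hθ : 0 < θ) (hθh : θ * h < 1) :
    riskIndex Pr f (f xstar) m x0 w σ θ ≤ ((limitBound σ h θ : ℝ) : EReal) := by
  have hs0 : 0 ≤ θ * h := by positivity
  have hB : 0 < (1 + θ * h) / (1 - θ * h) := div_pos (by linarith) (by linarith)
  set B := (1 + θ * h) / (1 - θ * h) with hBdef
  have hle : ∀ K : ℕ, riskCost Pr f (f xstar) m x0 w σ θ K
      ≤ ((2 * σ ^ 2 / θ * ((θ / (2 * σ ^ 2) * C + K * Real.log B) / ((K : ℝ) + 1)) : ℝ) :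
        EReal) := by
    intro K
    have hint : ∫⁻ ω, ENNReal.ofReal (Real.exp
        (θ / (2 * σ ^ 2) * cumulativeSubopt f (f xstar) m x0 w K ω)) ∂Pr
        ≤ ENNReal.ofReal (Real.exp (θ / (2 * σ ^ 2) * C) * B ^ K) := by
      calc _ ≤ ∫⁻ ω, ENNReal.ofReal (Real.exp (θ / (2 * σ ^ 2) * C)) * ENNReal.ofReal (Real.exp
            (θ * h * ∑ k ∈ Finset.range K, ‖w (k + 1) ω‖ ^ 2 / (2 * σ ^ 2))) ∂Pr := by
            refine lintegral_mono fun ω => ?_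
            rw [← ENNReal.ofReal_mul (Real.exp_nonneg _), ← Real.exp_add]
            refine ENNReal.ofReal_le_ofReal (Real.exp_le_exp.2 ?_)
            refine (mul_le_mul_of_nonneg_left (hS K ω) (by positivity)).trans_eq ?_
            rw [← Finset.sum_div]
            ring
        _ = ENNReal.ofReal (Real.exp (θ / (2 * σ ^ 2) * C)) * ∫⁻ ω, ENNReal.ofReal (Real.exp
            (θ * h * ∑ k ∈ Finset.range K, ‖w (k + 1) ω‖ ^ 2 / (2 * σ ^ 2))) ∂Pr :=
            lintegral_const_mul' _ _ ENNReal.ofReal_ne_top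
        _ ≤ _ := by
            rw [ENNReal.ofReal_mul (Real.exp_nonneg _), ENNReal.ofReal_pow hB.le]
            exact mul_le_mul_right (hw.lintegral_exp_sum_le hf hσ hs0 hθh K) _
    have hlog := ENNReal.log_le_log hint
    rw [ENNReal.log_ofReal_of_pos (by positivity), Real.log_mul (Real.exp_ne_zero _)
      (by positivity), Real.log_exp, Real.log_pow] at hlog
    refine (mul_le_mul_of_nonneg_left hlog (EReal.coe_nonneg.2 (by positivity))).trans_eq ?_
    rw [← EReal.coe_mul]
    congr 1
    field_simp
  have hlim : Tendsto (fun K : ℕ => ((2 * σ ^ 2 / θ * ((θ / (2 * σ ^ 2) * C + K * Real.log B)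
      / ((K : ℝ) + 1)) : ℝ) : EReal)) atTop (𝓝 ((limitBound σ h θ : ℝ) : EReal)) :=
    (continuous_coe_real_ereal.tendsto _).comp
      ((tendsto_affine_div_add_one _ (Real.log B)).const_mul (2 * σ ^ 2 / θ))
  exact (limsup_le_limsup (Eventually.of_forall hle)).trans_eq hlim.limsup_eq

/-- Jensen's inequality for the averaged iterate. -/
lemma SmoothStronglyConvex.averagedIterate_sub_le (hμ : 0 < μ) (hf : SmoothStronglyConvex μ L f)
    (K : ℕ) (ω : Ω) :
    f (averagedIterate f m x0 w K ω) - f xstar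
      ≤ ((K : ℝ) + 1)⁻¹ * cumulativeSubopt f (f xstar) m x0 w K ω := by
  have hconv : ConvexOn ℝ Set.univ f := by
    refine UniformConvexOn.convexOn hf.strongConvex fun r => ?_
    simp only [Pi.zero_apply]
    positivity
  have hK : (0 : ℝ) < (K : ℝ) + 1 := by positivity
  have h := hconv.map_sum_le (t := Finset.range (K + 1)) (w := fun _ => ((K : ℝ) + 1)⁻¹)
    (p := fun k => iterate f m x0 w k ω) (fun _ _ => by positivity)
    (by simp [mul_inv_cancel₀ hK.ne']) (fun _ _ => Set.mem_univ _)
  rw [averagedIterate, cumulativeSubopt, Finset.smul_sum, Finset.sum_sub_distrib, mul_sub,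
    Finset.sum_const, Finset.card_range, nsmul_eq_mul, Finset.mul_sum]
  push_cast
  rw [inv_mul_cancel_left₀ hK.ne']
  simpa using h

lemma SubGaussianNoise.averagedIterate_bound [IsProbabilityMeasure Pr] (hμ : 0 < μ)
    (hf : SmoothStronglyConvex μ L f) (hxstar : ∀ x, f xstar ≤ f x) (hσ : 0 < σ)
    (hw : SubGaussianNoise Pr f m x0 w σ) {C h : ℝ} (hh : 0 ≤ h)
    (hS : ∀ K ω, cumulativeSubopt f (f xstar) m x0 w K ω
      ≤ C + h * ∑ k ∈ Finset.range K, ‖w (k + 1) ω‖ ^ 2) (K : ℕ) :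
    Integrable (fun ω => f (averagedIterate f m x0 w K ω) - f xstar) Pr ∧
      ∫ ω, (f (averagedIterate f m x0 w K ω) - f xstar) ∂Pr
        ≤ (C + K * (4 * σ ^ 2 * h)) / ((K : ℝ) + 1) := by
  have hK : (0 : ℝ) < (K : ℝ) + 1 := by positivity
  have hle : ∀ ω, f (averagedIterate f m x0 w K ω) - f xstar
      ≤ ((K : ℝ) + 1)⁻¹ * (C + h * ∑ k ∈ Finset.range K, ‖w (k + 1) ω‖ ^ 2) := fun ω =>
    (hf.averagedIterate_sub_le hμ K ω).trans (mul_le_mul_of_nonneg_left (hS K ω) (by positivity))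
  have hsum : Integrable (fun ω => ∑ k ∈ Finset.range K, ‖w (k + 1) ω‖ ^ 2) Pr :=
    integrable_finsetSum _ fun k _ => hw.integrable_sq hf hσ k
  have hbound : Integrable
      (fun ω => ((K : ℝ) + 1)⁻¹ * (C + h * ∑ k ∈ Finset.range K, ‖w (k + 1) ω‖ ^ 2)) Pr :=
    ((integrable_const C).add (hsum.const_mul h)).const_mul _
  have hmeas : Measurable (fun ω => f (averagedIterate f m x0 w K ω) - f xstar) := by
    refine Measurable.sub_const (hf.contDiff.continuous.measurable.comp ?_) _
    exact (Finset.measurable_sum (Finset.range (K + 1)) fun k _ =>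
      measurable_iterate hf hw.measurable k).const_smul ((K : ℝ) + 1)⁻¹
  have hint : Integrable (fun ω => f (averagedIterate f m x0 w K ω) - f xstar) Pr := by
    refine hbound.mono' hmeas.aestronglyMeasurable (ae_of_all _ fun ω => ?_)
    rw [Real.norm_of_nonneg (sub_nonneg.2 (hxstar _))]
    exact hle ω
  refine ⟨hint, (integral_mono hint hbound hle).trans ?_⟩
  rw [integral_const_mul, integral_add (integrable_const C) (hsum.const_mul h), integral_const,
    integral_const_mul, integral_finsetSum _ fun k _ => hw.integrable_sq hf hσ k,
    inv_mul_eq_div]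
  have hs : ∑ k ∈ Finset.range K, ∫ ω, ‖w (k + 1) ω‖ ^ 2 ∂Pr ≤ K * (4 * σ ^ 2) := by
    simpa using Finset.sum_le_card_nsmul (Finset.range K) _ (4 * σ ^ 2)
      fun k _ => hw.integral_sq_le hf hσ k
  have := mul_le_mul_of_nonneg_left hs hh
  refine div_le_div_of_nonneg_right ?_ hK.le
  simp
  linarith

end Noise

end GMM

theorem mainTheorem5 {d : ℕ} {Ω : Type*} [MeasurableSpace Ω] (Pr : Measure Ω)
    [IsProbabilityMeasure Pr] (μ L : ℝ) (hμ : 0 < μ) (hμL : μ < L)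
    (f : EuclideanSpace ℝ (Fin d) → ℝ) (hf : GMM.SmoothStronglyConvex μ L f)
    (xstar : EuclideanSpace ℝ (Fin d)) (hxstar : ∀ x, f xstar ≤ f x)
    (m : GMM.Params) (hα : 0 < m.α) (hβ : 0 ≤ m.β) (hν : 0 ≤ m.ν)
    (x0 : EuclideanSpace ℝ (Fin d)) (w : ℕ → Ω → EuclideanSpace ℝ (Fin d))
    (σ : ℝ) (hσ : 0 < σ) (hw : GMM.SubGaussianNoise Pr f m x0 w σ)
    (c : GMM.Certificate) (hc : c.Feasible μ L m) :
    (∀ θ : ℝ, 0 < θ →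
      GMM.riskIndex Pr f (f xstar) m x0 w σ θ
          ≤ c.riskIndexBound μ L m σ (c.lyapunov f xstar x0 x0) θ ∧
      c.riskIndexBound μ L m σ (c.lyapunov f xstar x0 x0) θ =
        if Real.sqrt θ * c.Hbar μ L m < 1 then
          ((2 * σ ^ 2 / θ * Real.log ((1 + θ * c.Hbar μ L m ^ 2) /
            (1 - θ * c.Hbar μ L m ^ 2)) : ℝ) : EReal)
        else ⊤) ∧
    (∀ K : ℕ, Integrable (fun ω => f (GMM.averagedIterate f m x0 w K ω) - f xstar) Pr) ∧
    limsup (fun K : ℕ =>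
        ((∫ ω, (f (GMM.averagedIterate f m x0 w K ω) - f xstar) ∂Pr : ℝ) : EReal)) atTop
      ≤ ((4 * σ ^ 2 * c.Hbar μ L m ^ 2 : ℝ) : EReal) ∧
    Tendsto (fun θ : ℝ => c.riskIndexBound μ L m σ (c.lyapunov f xstar x0 x0) θ) (𝓝[>] 0)
      (𝓝 ((4 * σ ^ 2 * c.Hbar μ L m ^ 2 : ℝ) : EReal)) := by
  have hL := hμ.trans hμL
  have hh : 0 ≤ c.Hbar μ L m ^ 2 := sq_nonneg _
  obtain ⟨C, hC⟩ := hc.sum_sub_le hμ hμL hf hxstar x0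
  have hS : ∀ K ω, GMM.cumulativeSubopt f (f xstar) m x0 w K ω
      ≤ C + c.Hbar μ L m ^ 2 * ∑ k ∈ Finset.range K, ‖w (k + 1) ω‖ ^ 2 :=
    fun K ω => hC (fun j => w j ω) K
  have hE := hw.averagedIterate_bound hμ hf hxstar hσ hh hS
  refine ⟨fun θ hθ => ⟨?_, hc.riskIndexBound_eq hμ hL σ _ hθ⟩, fun K => (hE K).1, ?_,
    hc.tendsto_riskIndexBound hμ hL σ _⟩
  · rw [hc.riskIndexBound_eq hμ hL σ _ hθ]
    split_ifs with h
    · exact hw.riskIndex_le hf hσ hh hS hθ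
        ((GMM.Certificate.sqrt_mul_Hbar_lt_one_iff hθ.le).1 h)
    · exact le_top
  · have hlim := (continuous_coe_real_ereal.tendsto _).comp
      (GMM.tendsto_affine_div_add_one C (4 * σ ^ 2 * c.Hbar μ L m ^ 2))
    exact (limsup_le_limsup (Eventually.of_forall fun K =>
      EReal.coe_le_coe_iff.2 (hE K).2)).trans_eq hlim.limsup_eq
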